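/- Let $S_j, S_k \in \{\tfrac12, 1, \tfrac32, \dots\}$ be the spin values of the two nodes $j,k$ of an edge $e=\{j,k\}$, with Hilbert spaces of dimensions $2S_j+1$, $2S_k+1$ and spin operators $\vec S_j=(S_{j,x},S_{j,y},S_{j,z})$, $\vec S_k=(S_{k,x},S_{k,y},S_{k,z})$, and put $S_e = S_j+S_k$. Let $P_e$ be the orthogonal projector onto the subspace of total spin $S_e$ of the two spins (the eigenspace of $(\vec S_j+\vec S_k)^2$ for the eigenvalue $S_e(S_e+1)$) and let $Q_e = 1-P_e$. For a unit vector $\vec r\in\mathbb R^3$ let $|+\rangle_{j,\vec r}$ and $|-\rangle_{j,\vec r}$ be normalized eigenstates of $\vec S_j\cdot\vec r$ for the maximum eigenvalue $S_j$ and the minimum eigenvalue $-S_j$, define $|\pm\rangle_{k,\vec r}$ in the same way, put $|\pm\rangle_{e,\vec r} = |\pm\rangle_{j,\vec r}\otimes|\pm\rangle_{k,\vec r}$, and let $$R_{e,\vec r} = 1 - |+\rangle_{e,\vec r}\langle +| - |-\rangle_{e,\vec r}\langle -|.$$ For a probability distribution $\mu$ on the unit sphere of $\mathbb R^3$ let $\Omega_e(\mu)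 = \int R_{e,\vec r}\,\mathrm d\mu(\vec r)$ be the bond verification operator, let $\nu(\Omega_e(\mu)) = 1 - \|\Omega_e(\mu)-Q_e\|$ (operator norm) be its spectral gap, and let $\mu_{\mathrm{sym}}$ be the average of $\mu$ and its image under $\vec r\mapsto-\vec r$. Call $\Omega_e(\mu)$ homogeneous if $\Omega_e(\mu) = Q_e + \lambda(1-Q_e)$ for some real $\lambda$ with $0\le\lambda<1$. A probability distribution on the unit sphere is a spherical $t$-design if the average over it of every polynomial of degree at most $t$ in the coordinates equals the average over the isotropic (uniform) distribution. Then the following four statements are equivalent: 1. $\nu(\Omega_e(\mu)) = \dfrac{2}{2S_e+1}$. 2. $\Omega_e(\mu) = Q_e + \dfrac{2S_e-1}{2S_e+1}\,P_e$. 3. $\Omega_e(\mu)$ is homogeneous. 4. $\mu_{\mathrm{sym}}$ is a spherical $t$-design with $t=2S_e$. -/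

import Mathlib

namespace AKLT

open MeasureTheory Metric
open scoped Kronecker ENNReal

noncomputable section

/-- Euclidean three-space. -/
abbrev E3 : Type := EuclideanSpace ℝ (Fin 3)

/-- The unit sphere of Euclidean three-space. -/
abbrev S2 : Type := sphere (0 : E3) 1

/-- Operators on the finite-dimensional Hilbert space with orthonormal basis indexed by `ι`,
carrying the operator norm. -/
abbrev Op (ι : Type) [Fintype ι] : Type := EuclideanSpace ℂ ι →L[ℂ] EuclideanSpace ℂ ι

/-! ### Spin operators

The spin value is `d / 2`, with `d : ℕ`; the Hilbert space has dimension `d + 1`, and the basis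
vector with index `i` has magnetic quantum number `d / 2 - i`. -/

/-- The spin value `S = d / 2`. -/
def spinValue (d : ℕ) : ℝ := (d : ℝ) / 2

/-- The raising operator `S₊ |S, m⟩ = √((S - m) (S + m + 1)) |S, m + 1⟩`; for `m = S - k` the
coefficient is `√(k (2 S + 1 - k))`. -/
def spinPlus (d : ℕ) : Matrix (Fin (d + 1)) (Fin (d + 1)) ℂ :=
  Matrix.of fun i k =>
    if (i : ℕ) + 1 = (k : ℕ) then ((Real.sqrt ((k : ℝ) * ((d : ℝ) + 1 - (k : ℝ))) : ℝ) : ℂ) else 0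

/-- The lowering operator `S₋`, the adjoint of `S₊`. -/
def spinMinus (d : ℕ) : Matrix (Fin (d + 1)) (Fin (d + 1)) ℂ :=
  (spinPlus d).conjTranspose

def spinX (d : ℕ) : Matrix (Fin (d + 1)) (Fin (d + 1)) ℂ :=
  (1 / 2 : ℂ) • (spinPlus d + spinMinus d)

def spinY (d : ℕ) : Matrix (Fin (d + 1)) (Fin (d + 1)) ℂ :=
  (1 / (2 * Complex.I) : ℂ) • (spinPlus d - spinMinus d)

def spinZ (d : ℕ) : Matrix (Fin (d + 1)) (Fin (d + 1)) ℂ :=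
  Matrix.diagonal fun i => ((spinValue d - (i : ℝ) : ℝ) : ℂ)

/-- The three components `(S_x, S_y, S_z)` of the spin operator. -/
def spin (d : ℕ) : Fin 3 → Matrix (Fin (d + 1)) (Fin (d + 1)) ℂ :=
  ![spinX d, spinY d, spinZ d]

/-- The spin operator `S_r = r_x S_x + r_y S_y + r_z S_z` along the direction `r`. -/
def spinAlong (d : ℕ) (r : S2) : Matrix (Fin (d + 1)) (Fin (d + 1)) ℂ :=
  ∑ i : Fin 3, ((r.1 i : ℝ) : ℂ) • spin d i

/-- The orthogonal projector onto the eigenspace of the matrix `A` for the number `c`. -/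
def eigenProj {ι : Type} [Fintype ι] [DecidableEq ι] (A : Matrix ι ι ℂ) (c : ℝ) : Op ι :=
  (Module.End.eigenspace (Matrix.toEuclideanLin A) (c : ℂ)).starProjection

/-- The projector `|+⟩⟨+|` onto the eigenstate of `S_r` with the maximum eigenvalue `S`. -/
def plusProj (d : ℕ) (r : S2) : Op (Fin (d + 1)) :=
  eigenProj (spinAlong d r) (spinValue d)

/-- The projector `|-⟩⟨-|` onto the eigenstate of `S_r` with the minimum eigenvalue `-S`. -/
def minusProj (d : ℕ) (r : S2) : Op (Fin (d + 1)) :=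
  eigenProj (spinAlong d r) (-spinValue d)

/-! ### Two spins -/

/-- The tensor product of two operators, on the Hilbert space of the pair of systems. -/
def tensorOp {ι κ : Type} [Fintype ι] [DecidableEq ι] [Fintype κ] [DecidableEq κ]
    (A : Op ι) (B : Op κ) : Op (ι × κ) :=
  Matrix.toEuclideanCLM (n := ι × κ) (𝕜 := ℂ)
    ((Matrix.toEuclideanCLM (n := ι) (𝕜 := ℂ)).symm A ⊗ₖ
      (Matrix.toEuclideanCLM (n := κ) (𝕜 := ℂ)).symm B)

/-- Operators on the Hilbert space of two spins with values `a / 2` and `b / 2`. -/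
abbrev BondOp (a b : ℕ) : Type := Op (Fin (a + 1) × Fin (b + 1))

/-- The components of the total spin of two spins. -/
def totalSpin (a b : ℕ) (i : Fin 3) :
    Matrix (Fin (a + 1) × Fin (b + 1)) (Fin (a + 1) × Fin (b + 1)) ℂ :=
  spin a i ⊗ₖ (1 : Matrix (Fin (b + 1)) (Fin (b + 1)) ℂ) +
    (1 : Matrix (Fin (a + 1)) (Fin (a + 1)) ℂ) ⊗ₖ spin b i

/-- The maximum total spin `S_e = S_j + S_k`. -/
def maxSpin (a b : ℕ) : ℝ := spinValue a + spinValue b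

/-- The projector `P_e` onto the subspace of total spin `S_e`, that is, the eigenspace of the
squared total spin for the eigenvalue `S_e (S_e + 1)`. -/
def P (a b : ℕ) : BondOp a b :=
  eigenProj (∑ i : Fin 3, totalSpin a b i * totalSpin a b i) (maxSpin a b * (maxSpin a b + 1))

/-- The complementary projector `Q_e = 1 - P_e`. -/
def Q (a b : ℕ) : BondOp a b := 1 - P a b

/-- The bond test projector `R_{e,r}`: the test is passed unless both spin measurements along `r`
give the maximum eigenvalue or both give the minimum eigenvalue. -/
def bondTest (a b : ℕ) (r : S2) : BondOp a b :=
  1 - tensorOp (plusProj a r) (plusProj b r) - tensorOp (minusProj a r) (minusProj b r)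

/-- The bond verification operator `Ω_e(μ)`, the average of the bond tests over `μ`. -/
def bondVerification (a b : ℕ) (μ : Measure S2) : BondOp a b :=
  ∫ r, bondTest a b r ∂μ

/-! ### Verification of the range of a projector -/

/-- The spectral gap `ν(Ω) = 1 - ‖Ω - Q‖` of an operator `Ω` that verifies the range of the
projector `Q`. -/
def spectralGap {ι : Type} [Fintype ι] (Q Ω : Op ι) : ℝ := 1 - ‖Ω - Q‖

/-- `Ω` is homogeneous: `Ω = Q + c (1 - Q)` for some real `c` with `0 ≤ c < 1`. -/
def IsHomogeneous {ι : Type} [Fintype ι] (Q Ω : Op ι) : Prop :=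
  ∃ c : ℝ, 0 ≤ c ∧ c < 1 ∧ Ω = Q + c • (1 - Q)

/-! ### Spherical designs -/

/-- The isotropic probability distribution on the unit sphere: normalized surface measure. -/
def isotropic : Measure S2 :=
  ((volume : Measure E3).toSphere Set.univ)⁻¹ • (volume : Measure E3).toSphere

/-- A distribution on the unit sphere is a spherical `t`-design if the average of every real
polynomial of degree at most `t` equals its average over the isotropic distribution. -/
def IsSphericalDesign (t : ℕ) (μ : Measure S2) : Prop :=
  ∀ p : MvPolynomial (Fin 3) ℝ, p.totalDegree ≤ t →
    ∫ r : S2, MvPolynomial.eval (fun i => r.1 i) p ∂μ =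
      ∫ r : S2, MvPolynomial.eval (fun i => r.1 i) p ∂isotropic

/-- The average of a distribution and its center inversion. -/
def symmetrization (μ : Measure S2) : Measure S2 :=
  (2 : ℝ≥0∞)⁻¹ • (μ + μ.map (fun r => -r))

end

end AKLT

namespace AKLT

open MeasureTheory Metric
open scoped Kronecker ENNReal ComplexConjugate ComplexOrder Pointwise

noncomputable section

/-! ### Spinors -/

/-! Let `n = a + b = 2 S_e`. The top eigenvector of the spin along `r` is a coherent state: the
symmetric power of a unit spinor `(u, v)` with Bloch vector `r`. The bottom eigenvector is the
coherent state along `-r`, so `Ω = 1 - 2N`, where `N` is the average over `symmetrization μ` of the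
projectors onto products of two parallel coherent states. Such a product is the coherent state of
spin `S_e`. Hence `N` is supported on the range of `X = maxSpinProj a b`, of dimension `n + 1`, it
has trace 1, and `Ω - Q = X - 2N` (matrices and operators being identified).

Homogeneity says that `N` is a multiple of `X`, and the trace forces `N = X / (n + 1)`, which is
statement 2. If `‖X - 2N‖ = 1 - 2 / (n + 1)`, then `(1 - 2 / (n + 1)) X - (X - 2N)` is positive
semidefinite with trace 0, hence zero (`eq_smul_of_norm_eq`), which again is statement 2.

For designs, the entries of `N` are, up to nonzero binomial weights, the averages of the kernels
`u^(n-K) v^K conj (u^(n-L) v^L)`. These kernels span the polynomials of degree at most `n` on the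
sphere (`forall_integral_eval_eq_iff`), so `N` encodes exactly the moments up to degree `n`.
Rotation invariance gives the isotropic averages (`integral_spinorKernel_isotropic`), and they are
the entries of `X / (n + 1)`. -/

lemma sphere_sq_sum (r : S2) : r.1 0 ^ 2 + r.1 1 ^ 2 + r.1 2 ^ 2 = 1 := by
  have h : ‖r.1‖ = 1 := by simp
  rw [EuclideanSpace.norm_eq, Real.sqrt_eq_one, Fin.sum_univ_three] at h
  simpa using h

/-- The three products are the entries of the projector `(1 + r · σ) / 2`. Away from the south pole
`u` can be taken real and positive; at the south pole `u = 0` and `v` is a free phase. No continuous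
choice exists on the whole sphere, so later arguments rely only on these phase-independent products.
-/
lemma exists_spinor (r : S2) : ∃ u v : ℂ,
    u * conj u = (1 + (r.1 2 : ℝ)) / 2 ∧ v * conj v = (1 - (r.1 2 : ℝ)) / 2 ∧
      conj u * v = ((r.1 0 : ℝ) + (r.1 1 : ℝ) * Complex.I) / 2 := by
  have hr := sphere_sq_sum r
  by_cases hz : r.1 2 = -1
  · have h0 : r.1 0 = 0 := by nlinarith [sq_nonneg (r.1 0), sq_nonneg (r.1 1)]
    have h1 : r.1 1 = 0 := by nlinarith [sq_nonneg (r.1 0), sq_nonneg (r.1 1)]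
    exact ⟨0, 1, by simp [hz], by simp [hz], by simp [h0, h1]⟩
  · have hpos : 0 < (1 + r.1 2) / 2 := by
      have : -1 < r.1 2 := lt_of_le_of_ne
        (by nlinarith [sq_nonneg (r.1 0), sq_nonneg (r.1 1)]) (Ne.symm hz)
      linarith
    set s : ℝ := Real.sqrt ((1 + r.1 2) / 2) with hs
    have hs2 : s * s = (1 + r.1 2) / 2 := Real.mul_self_sqrt hpos.le
    have hs0 : s ≠ 0 := (Real.sqrt_pos.2 hpos).ne'
    have hsC : (s : ℂ) ≠ 0 := by exact_mod_cast hs0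
    refine ⟨s, ((r.1 0 : ℝ) + (r.1 1 : ℝ) * Complex.I) / (2 * s), ?_, ?_, ?_⟩
    · have h := congrArg Complex.ofReal hs2
      push_cast at h
      rw [Complex.conj_ofReal]; exact h
    · have h4 : (1 - r.1 2) / 2 * (4 * (s * s)) = r.1 0 ^ 2 + r.1 1 ^ 2 := by
        rw [hs2]; linarith
      have h4C : ((1 : ℂ) - (r.1 2 : ℝ)) / 2 * (4 * ((s : ℂ) * s))
          = (r.1 0 : ℝ) ^ 2 + (r.1 1 : ℝ) ^ 2 := by exact_mod_cast h4
      simp only [map_div₀, map_add, map_mul, Complex.conj_ofReal, Complex.conj_I, map_ofNat]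
      field_simp
      linear_combination (-1/2 : ℂ) * h4C * 2 - (r.1 1 : ℂ) ^ 2 * Complex.I_sq
    · rw [Complex.conj_ofReal]; field_simp

/-- The first component of a unit spinor pointing in the direction `r`. -/
def up (r : S2) : ℂ := (exists_spinor r).choose

/-- The second component of a unit spinor pointing in the direction `r`. -/
def down (r : S2) : ℂ := (exists_spinor r).choose_spec.choose

lemma up_mul_conj (r : S2) : up r * conj (up r) = (1 + (r.1 2 : ℝ)) / 2 :=
  (exists_spinor r).choose_spec.choose_spec.1

lemma down_mul_conj (r : S2) : down r * conj (down r) = (1 - (r.1 2 : ℝ)) / 2 :=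
  (exists_spinor r).choose_spec.choose_spec.2.1

lemma conj_up_mul_down (r : S2) :
    conj (up r) * down r = ((r.1 0 : ℝ) + (r.1 1 : ℝ) * Complex.I) / 2 :=
  (exists_spinor r).choose_spec.choose_spec.2.2

lemma up_mul_conj_down (r : S2) :
    up r * conj (down r) = ((r.1 0 : ℝ) - (r.1 1 : ℝ) * Complex.I) / 2 := by
  have h := congrArg conj (conj_up_mul_down r)
  simp only [map_div₀, map_add, map_mul, Complex.conj_ofReal, Complex.conj_I, map_ofNat,
    Complex.conj_conj] at h
  rw [h]; ring

lemma spinor_norm (r : S2) : up r * conj (up r) + down r * conj (down r) = 1 := by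
  rw [up_mul_conj, down_mul_conj]; ring

/-- The matrix entries of the `n`-th tensor power of the projector onto the spinor along `r`. -/
def spinorKernel (n K L : ℕ) (r : S2) : ℂ :=
  (up r ^ (n - K) * down r ^ K) * conj (up r ^ (n - L) * down r ^ L)

/-- Tensor powers of one spinor multiply, and only the sums of the indices survive. This is why a
product of two coherent projectors depends on `i + j` alone. -/
lemma spinorKernel_mul {m n K L k l : ℕ} (hK : K ≤ m) (hL : L ≤ m) (hk : k ≤ n) (hl : l ≤ n)
    (r : S2) :
    spinorKernel m K L r * spinorKernel n k l r = spinorKernel (m + n) (K + k) (L + l) r := by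
  have h1 : m + n - (K + k) = (m - K) + (n - k) := by omega
  have h2 : m + n - (L + l) = (m - L) + (n - l) := by omega
  simp only [spinorKernel, h1, h2, pow_add, map_mul]
  ring

/-- A complex function on the sphere whose real and imaginary parts are polynomials of degree at
most `n` in the coordinates. -/
def IsPolyOfDegreeLE (n : ℕ) (f : S2 → ℂ) : Prop :=
  ∃ p q : MvPolynomial (Fin 3) ℝ, p.totalDegree ≤ n ∧ q.totalDegree ≤ n ∧
    ∀ r, f r = (MvPolynomial.eval (fun i => r.1 i) p : ℝ) +
      (MvPolynomial.eval (fun i => r.1 i) q : ℝ) * Complex.I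

lemma IsPolyOfDegreeLE.mul {m n : ℕ} {f g : S2 → ℂ} (hf : IsPolyOfDegreeLE m f)
    (hg : IsPolyOfDegreeLE n g) : IsPolyOfDegreeLE (m + n) (fun r => f r * g r) := by
  obtain ⟨p, q, hp, hq, h⟩ := hf
  obtain ⟨p', q', hp', hq', h'⟩ := hg
  refine ⟨p * p' - q * q', p * q' + q * p', ?_, ?_, fun r => ?_⟩
  · exact (MvPolynomial.totalDegree_sub _ _).trans (max_le
      ((MvPolynomial.totalDegree_mul _ _).trans (by omega))
      ((MvPolynomial.totalDegree_mul _ _).trans (by omega)))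
  · exact (MvPolynomial.totalDegree_add _ _).trans (max_le
      ((MvPolynomial.totalDegree_mul _ _).trans (by omega))
      ((MvPolynomial.totalDegree_mul _ _).trans (by omega)))
  · simp only [h, h', map_sub, map_add, map_mul]
    push_cast
    linear_combination ((MvPolynomial.eval (fun i => r.1 i) q : ℝ) : ℂ) *
      (MvPolynomial.eval (fun i => r.1 i) q' : ℝ) * Complex.I_sq

lemma isPolyOfDegreeLE_spinorKernel_one {k l : ℕ} (hk : k ≤ 1) (hl : l ≤ 1) :
    IsPolyOfDegreeLE 1 (spinorKernel 1 k l) := by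
  have hdeg (c : ℝ) (i : Fin 3) : (MvPolynomial.C c * MvPolynomial.X i).totalDegree ≤ 1 :=
    (MvPolynomial.totalDegree_mul _ _).trans (by simp)
  have hdeg' (c d : ℝ) (i : Fin 3) :
      (MvPolynomial.C d + MvPolynomial.C c * MvPolynomial.X i).totalDegree ≤ 1 :=
    (MvPolynomial.totalDegree_add _ _).trans (by simpa using hdeg c i)
  interval_cases k <;> interval_cases l
  · refine ⟨_, _, hdeg' (1 / 2) (1 / 2) 2, hdeg 0 2, fun r => ?_⟩
    have := up_mul_conj r
    simp [spinorKernel, this]; ring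
  · refine ⟨_, _, hdeg (1 / 2) 0, hdeg (-1 / 2) 1, fun r => ?_⟩
    have := up_mul_conj_down r
    simp [spinorKernel, this]; ring
  · refine ⟨_, _, hdeg (1 / 2) 0, hdeg (1 / 2) 1, fun r => ?_⟩
    have := conj_up_mul_down r
    rw [mul_comm] at this
    simp [spinorKernel, this]; ring
  · refine ⟨_, _, hdeg' (-1 / 2) (1 / 2) 2, hdeg 0 2, fun r => ?_⟩
    have := down_mul_conj r
    simp [spinorKernel, this]; ring

lemma isPolyOfDegreeLE_spinorKernel (n : ℕ) : ∀ {K L : ℕ}, K ≤ n → L ≤ n →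
    IsPolyOfDegreeLE n (spinorKernel n K L) := by
  induction n with
  | zero =>
    intro K L hK hL
    obtain rfl : K = 0 := by omega
    obtain rfl : L = 0 := by omega
    exact ⟨1, 0, by simp, by simp, fun r => by simp [spinorKernel]⟩
  | succ n ih =>
    intro K L hK hL
    obtain ⟨K', k, hK', hk, rfl⟩ : ∃ K' k, K' ≤ n ∧ k ≤ 1 ∧ K = K' + k :=
      ⟨min K n, K - min K n, by omega, by omega, by omega⟩
    obtain ⟨L', l, hL', hl, rfl⟩ : ∃ L' l, L' ≤ n ∧ l ≤ 1 ∧ L = L' + l :=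
      ⟨min L n, L - min L n, by omega, by omega, by omega⟩
    have h := (ih hK' hL').mul (isPolyOfDegreeLE_spinorKernel_one hk hl)
    simpa only [spinorKernel_mul hK' hL' hk hl] using h

lemma continuous_eval_coord (p : MvPolynomial (Fin 3) ℝ) :
    Continuous fun r : S2 => MvPolynomial.eval (fun i => r.1 i) p :=
  (MvPolynomial.continuous_eval p).comp (by fun_prop)

/-- `up` and `down` are arbitrary choices and need not be continuous; continuity comes from the
polynomial form of the kernel. -/
lemma continuous_spinorKernel {n K L : ℕ} (hK : K ≤ n) (hL : L ≤ n) :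
    Continuous (spinorKernel n K L) := by
  obtain ⟨p, q, -, -, h⟩ := isPolyOfDegreeLE_spinorKernel n hK hL
  rw [funext h]
  have hp := continuous_eval_coord p
  have hq := continuous_eval_coord q
  fun_prop

lemma integrable_of_continuous {E : Type*} [NormedAddCommGroup E] (μ : Measure S2)
    [IsFiniteMeasure μ] {f : S2 → E} (hf : Continuous f) : Integrable f μ :=
  hf.integrable_of_hasCompactSupport (HasCompactSupport.of_compactSpace f)

/-! ### Polynomials as combinations of spinor kernels -/

/-- The linear span of the spinor kernels of order `n`. -/
def kernelSpan (n : ℕ) : Submodule ℂ (S2 → ℂ) :=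
  Submodule.span ℂ {f | ∃ K L, K ≤ n ∧ L ≤ n ∧ f = spinorKernel n K L}

lemma spinorKernel_mem_kernelSpan {n K L : ℕ} (hK : K ≤ n) (hL : L ≤ n) :
    spinorKernel n K L ∈ kernelSpan n :=
  Submodule.subset_span ⟨K, L, hK, hL, rfl⟩

lemma mul_mem_kernelSpan {m n : ℕ} {f g : S2 → ℂ} (hf : f ∈ kernelSpan m)
    (hg : g ∈ kernelSpan n) : f * g ∈ kernelSpan (m + n) := by
  refine Submodule.span_induction ?_ ?_ ?_ ?_ hf
  · rintro _ ⟨K, L, hK, hL, rfl⟩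
    refine Submodule.span_induction ?_ ?_ ?_ ?_ hg
    · rintro _ ⟨k, l, hk, hl, rfl⟩
      refine Submodule.subset_span ⟨K + k, L + l, by omega, by omega, ?_⟩
      funext r
      exact spinorKernel_mul hK hL hk hl r
    · simp
    · intro x y _ _ hx hy
      rw [mul_add]; exact add_mem hx hy
    · intro c x _ hx
      rw [mul_smul_comm]; exact Submodule.smul_mem _ _ hx
  · simp
  · intro x y _ _ hx hy
    rw [add_mul]; exact add_mem hx hy
  · intro c x _ hx
    rw [smul_mul_assoc]; exact Submodule.smul_mem _ _ hx

lemma one_mem_kernelSpan_one : (1 : S2 → ℂ) ∈ kernelSpan 1 := by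
  have : (1 : S2 → ℂ) = spinorKernel 1 0 0 + spinorKernel 1 1 1 := by
    funext r
    have := spinor_norm r
    simp [spinorKernel, this]
  rw [this]
  exact add_mem (spinorKernel_mem_kernelSpan (by omega) (by omega))
    (spinorKernel_mem_kernelSpan (by omega) (by omega))

lemma one_mem_kernelSpan (n : ℕ) : (1 : S2 → ℂ) ∈ kernelSpan n := by
  induction n with
  | zero =>
    have : (1 : S2 → ℂ) = spinorKernel 0 0 0 := by funext r; simp [spinorKernel]
    rw [this]; exact spinorKernel_mem_kernelSpan le_rfl le_rfl
  | succ n ih => simpa using mul_mem_kernelSpan ih one_mem_kernelSpan_one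

/-- Multiplying by `1 = (|u|² + |v|²)^(n - m)` raises the order of a kernel without changing the
function. -/
lemma kernelSpan_mono {m n : ℕ} (h : m ≤ n) : kernelSpan m ≤ kernelSpan n := by
  intro f hf
  have := mul_mem_kernelSpan hf (one_mem_kernelSpan (n - m))
  rwa [mul_one, Nat.add_sub_cancel' h] at this

lemma coord_mem_kernelSpan (i : Fin 3) : (fun r : S2 => ((r.1 i : ℝ) : ℂ)) ∈ kernelSpan 1 := by
  have h00 : spinorKernel 1 0 0 ∈ kernelSpan 1 := spinorKernel_mem_kernelSpan (by omega) (by omega)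
  have h01 : spinorKernel 1 0 1 ∈ kernelSpan 1 := spinorKernel_mem_kernelSpan (by omega) (by omega)
  have h10 : spinorKernel 1 1 0 ∈ kernelSpan 1 := spinorKernel_mem_kernelSpan (by omega) (by omega)
  have h11 : spinorKernel 1 1 1 ∈ kernelSpan 1 := spinorKernel_mem_kernelSpan (by omega) (by omega)
  fin_cases i
  · convert add_mem h01 h10 using 1
    funext r
    have h := up_mul_conj_down r
    have h' := conj_up_mul_down r
    rw [mul_comm] at h'
    simp [spinorKernel, h, h']; ring
  · convert Submodule.smul_mem _ Complex.I (sub_mem h01 h10) using 1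
    funext r
    have h := up_mul_conj_down r
    have h' := conj_up_mul_down r
    rw [mul_comm] at h'
    simp [spinorKernel, h, h']
    linear_combination (r.1 1 : ℂ) * Complex.I_sq
  · convert sub_mem h00 h11 using 1
    funext r
    have h := up_mul_conj r
    have h' := down_mul_conj r
    simp [spinorKernel, h, h']; ring

lemma pow_mem_kernelSpan {f : S2 → ℂ} (hf : f ∈ kernelSpan 1) (k : ℕ) :
    f ^ k ∈ kernelSpan k := by
  induction k with
  | zero => simpa using one_mem_kernelSpan 0
  | succ k ih => rw [pow_succ]; exact mul_mem_kernelSpan ih hf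

lemma eval_mem_kernelSpan {n : ℕ} (p : MvPolynomial (Fin 3) ℝ) (hp : p.totalDegree ≤ n) :
    (fun r : S2 => ((MvPolynomial.eval (fun i => r.1 i) p : ℝ) : ℂ)) ∈ kernelSpan n := by
  have : (fun r : S2 => ((MvPolynomial.eval (fun i => r.1 i) p : ℝ) : ℂ)) =
      ∑ d ∈ p.support, ((MvPolynomial.coeff d p : ℝ) : ℂ) •
        ((fun r : S2 => ((r.1 0 : ℝ) : ℂ)) ^ d 0 * (fun r : S2 => ((r.1 1 : ℝ) : ℂ)) ^ d 1 *
          (fun r : S2 => ((r.1 2 : ℝ) : ℂ)) ^ d 2) := by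
    funext r
    rw [MvPolynomial.eval_eq']
    simp [Fin.prod_univ_three]
  rw [this]
  refine Submodule.sum_mem _ fun d hd => Submodule.smul_mem _ _ ?_
  have hle : d 0 + d 1 + d 2 ≤ n := by
    have h := (MvPolynomial.le_totalDegree hd).trans hp
    rw [Finsupp.sum_fintype _ _ (by simp), Fin.sum_univ_three] at h
    exact h
  exact kernelSpan_mono hle (mul_mem_kernelSpan (mul_mem_kernelSpan
    (pow_mem_kernelSpan (coord_mem_kernelSpan 0) _) (pow_mem_kernelSpan (coord_mem_kernelSpan 1) _))
    (pow_mem_kernelSpan (coord_mem_kernelSpan 2) _))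

lemma integrable_spinorKernel (μ : Measure S2) [IsFiniteMeasure μ] {n K L : ℕ} (hK : K ≤ n)
    (hL : L ≤ n) : Integrable (spinorKernel n K L) μ :=
  integrable_of_continuous μ (continuous_spinorKernel hK hL)

lemma integral_complex_eval_eq {n : ℕ} {μ ν : Measure S2} [IsFiniteMeasure μ] [IsFiniteMeasure ν]
    (h : ∀ p : MvPolynomial (Fin 3) ℝ, p.totalDegree ≤ n →
      ∫ r : S2, MvPolynomial.eval (fun i => r.1 i) p ∂μ =
        ∫ r : S2, MvPolynomial.eval (fun i => r.1 i) p ∂ν)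
    {f : S2 → ℂ} (hf : IsPolyOfDegreeLE n f) : ∫ r, f r ∂μ = ∫ r, f r ∂ν := by
  obtain ⟨p, q, hp, hq, hf⟩ := hf
  have key (κ : Measure S2) [IsFiniteMeasure κ] : ∫ r, f r ∂κ =
      (∫ r : S2, MvPolynomial.eval (fun i => r.1 i) p ∂κ : ℝ) +
        (∫ r : S2, MvPolynomial.eval (fun i => r.1 i) q ∂κ : ℝ) * Complex.I := by
    simp_rw [hf]
    rw [integral_add, integral_mul_const, integral_complex_ofReal, integral_complex_ofReal]
    · exact (integrable_of_continuous κ (continuous_eval_coord p)).ofReal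
    · exact (integrable_of_continuous κ (continuous_eval_coord q)).ofReal.mul_const _
  rw [key μ, key ν, h p hp, h q hq]

/-- Two finite measures give the same averages of all polynomials of degree at most `n` iff they
give the same averages of the spinor kernels of order `n`. -/
lemma forall_integral_eval_eq_iff {n : ℕ} {μ ν : Measure S2} [IsFiniteMeasure μ]
    [IsFiniteMeasure ν] :
    (∀ p : MvPolynomial (Fin 3) ℝ, p.totalDegree ≤ n →
      ∫ r : S2, MvPolynomial.eval (fun i => r.1 i) p ∂μ =
        ∫ r : S2, MvPolynomial.eval (fun i => r.1 i) p ∂ν) ↔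
    ∀ K L, K ≤ n → L ≤ n →
      ∫ r, spinorKernel n K L r ∂μ = ∫ r, spinorKernel n K L r ∂ν := by
  refine ⟨fun h K L hK hL =>
    integral_complex_eval_eq h (isPolyOfDegreeLE_spinorKernel n hK hL), fun h p hp => ?_⟩
  have key : ∀ f ∈ kernelSpan n, Integrable f μ ∧ Integrable f ν ∧
      ∫ r, f r ∂μ = ∫ r, f r ∂ν := by
    intro f hf
    refine Submodule.span_induction ?_ ?_ ?_ ?_ hf
    · rintro _ ⟨K, L, hK, hL, rfl⟩
      exact ⟨integrable_spinorKernel μ hK hL, integrable_spinorKernel ν hK hL, h K L hK hL⟩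
    · exact ⟨integrable_zero _ _ _, integrable_zero _ _ _, by simp⟩
    · rintro x y _ _ ⟨h1, h2, h3⟩ ⟨h4, h5, h6⟩
      refine ⟨h1.add h4, h2.add h5, ?_⟩
      simp only [Pi.add_apply]
      rw [integral_add h1 h4, integral_add h2 h5, h3, h6]
    · rintro c x _ ⟨h1, h2, h3⟩
      refine ⟨h1.smul c, h2.smul c, ?_⟩
      simp only [Pi.smul_apply]
      rw [integral_smul, integral_smul, h3]
  have := (key _ (eval_mem_kernelSpan p hp)).2.2
  rw [integral_complex_ofReal, integral_complex_ofReal] at this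
  exact_mod_cast this

/-! ### Spin operators in the basis rescaled by binomial weights -/

/-- The square root of a binomial coefficient, as a complex number. -/
def binomWeight (d k : ℕ) : ℂ := ((Real.sqrt (d.choose k : ℝ) : ℝ) : ℂ)

lemma binomWeight_mul_self (d k : ℕ) : binomWeight d k * binomWeight d k = (d.choose k : ℂ) := by
  rw [binomWeight, ← Complex.ofReal_mul, Real.mul_self_sqrt (Nat.cast_nonneg _)]
  simp

lemma conj_binomWeight (d k : ℕ) : conj (binomWeight d k) = binomWeight d k :=
  Complex.conj_ofReal _

lemma binomWeight_ne_zero {d k : ℕ} (h : k ≤ d) : binomWeight d k ≠ 0 := by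
  rw [binomWeight, Complex.ofReal_ne_zero]
  exact (Real.sqrt_pos.2 (by exact_mod_cast Nat.choose_pos h)).ne'

/-- The action of the spin components on coefficients rescaled by binomial weights. -/
def ladder (d : ℕ) : Fin 3 → (ℕ → ℂ) → ℕ → ℂ :=
  ![fun y i => (1 / 2) * (((d : ℂ) - i) * y (i + 1) + i * y (i - 1)),
    fun y i => (-Complex.I / 2) * (((d : ℂ) - i) * y (i + 1) - i * y (i - 1)),
    fun y i => ((d : ℂ) / 2 - i) * y i]

/-- Rescaling by `√(d choose k)` clears the square roots of the ladder operators: they become the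
first-order operators of `ladder`, with linear coefficients. -/
lemma sqrt_mul_binomWeight {d i : ℕ} (h : i < d) :
    ((Real.sqrt (((i + 1 : ℕ) : ℝ) * ((d : ℝ) + 1 - ((i + 1 : ℕ) : ℝ))) : ℝ) : ℂ) *
      binomWeight d (i + 1) = binomWeight d i * ((d : ℂ) - i) := by
  have hd : (0 : ℝ) ≤ (d : ℝ) - i := by
    have : (i : ℝ) ≤ d := by exact_mod_cast h.le
    linarith
  have hc : ((d.choose (i + 1) : ℕ) : ℝ) * (i + 1) = d.choose i * ((d : ℝ) - i) := by
    have := Nat.choose_succ_right_eq d i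
    rw [← Nat.cast_sub h.le]
    exact_mod_cast this
  have h1 : ((i + 1 : ℕ) : ℝ) * ((d : ℝ) + 1 - ((i + 1 : ℕ) : ℝ)) * (d.choose (i + 1) : ℝ) =
      (d.choose i : ℝ) * ((d : ℝ) - i) ^ 2 := by
    push_cast
    linear_combination ((d : ℝ) - i) * hc
  rw [binomWeight, ← Complex.ofReal_mul, ← Real.sqrt_mul (by push_cast; nlinarith), h1,
    Real.sqrt_mul (Nat.cast_nonneg _), Real.sqrt_sq hd, binomWeight]
  push_cast
  ring

lemma sqrt_mul_binomWeight' {d i : ℕ} (h : i < d) :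
    ((Real.sqrt (((i + 1 : ℕ) : ℝ) * ((d : ℝ) + 1 - ((i + 1 : ℕ) : ℝ))) : ℝ) : ℂ) *
      binomWeight d i = binomWeight d (i + 1) * ((i : ℂ) + 1) := by
  have h1 := sqrt_mul_binomWeight h
  set s : ℂ := ((Real.sqrt (((i + 1 : ℕ) : ℝ) * ((d : ℝ) + 1 - ((i + 1 : ℕ) : ℝ))) : ℝ) : ℂ)
  have hss : s * s = ((i : ℂ) + 1) * ((d : ℂ) - i) := by
    have : (i : ℝ) + 1 ≤ d := by exact_mod_cast h
    rw [← Complex.ofReal_mul, Real.mul_self_sqrt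
      (mul_nonneg (by positivity) (by push_cast; linarith))]
    push_cast; ring
  have hd : (d : ℂ) - i ≠ 0 := by
    rw [sub_ne_zero]; exact_mod_cast h.ne'
  apply mul_right_cancel₀ hd
  linear_combination binomWeight d (i + 1) * hss - s * h1

/-- At the top index `i = d` the out-of-range value `y (d + 1)` has coefficient `d - i = 0`, so `y`
may be any sequence on `ℕ`. -/
lemma sum_spinPlus_mul (d : ℕ) (y : ℕ → ℂ) (i : Fin (d + 1)) :
    ∑ k : Fin (d + 1), spinPlus d i k * (binomWeight d k * y k) =
      binomWeight d i * (((d : ℂ) - (i : ℕ)) * y (i + 1)) := by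
  by_cases hi : (i : ℕ) < d
  · rw [Finset.sum_eq_single (⟨i + 1, by omega⟩ : Fin (d + 1))]
    · have h := sqrt_mul_binomWeight hi
      simp only [spinPlus, Matrix.of_apply, if_true]
      rw [← mul_assoc, h]; ring
    · intro k _ hk
      have : (i : ℕ) + 1 ≠ k := fun h => hk (Fin.ext h.symm)
      simp [spinPlus, this]
    · simp
  · have hid : (i : ℕ) = d := by omega
    rw [Finset.sum_eq_zero]
    · simp [hid]
    · intro k _
      have : (i : ℕ) + 1 ≠ k := by omega
      simp [spinPlus, this]

lemma sum_spinMinus_mul (d : ℕ) (y : ℕ → ℂ) (i : Fin (d + 1)) :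
    ∑ k : Fin (d + 1), spinMinus d i k * (binomWeight d k * y k) =
      binomWeight d i * (((i : ℕ) : ℂ) * y (i - 1)) := by
  obtain ⟨i, hi⟩ := i
  cases i with
  | zero =>
    rw [Finset.sum_eq_zero]
    · simp
    · intro k _
      simp [spinMinus, spinPlus, Matrix.conjTranspose_apply]
  | succ i =>
    rw [Finset.sum_eq_single (⟨i, by omega⟩ : Fin (d + 1))]
    · have h := sqrt_mul_binomWeight' (show i < d by omega)
      simp only [spinMinus, spinPlus, Matrix.conjTranspose_apply, Matrix.of_apply, if_true,
        RCLike.star_def, Complex.conj_ofReal, Nat.add_sub_cancel]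
      rw [← mul_assoc, h]; push_cast; ring
    · intro k _ hk
      have : (k : ℕ) ≠ i := fun h => hk (Fin.ext h)
      simp [spinMinus, spinPlus, Matrix.conjTranspose_apply, this]
    · simp

lemma sum_spin_mul (d : ℕ) (c : Fin 3) (y : ℕ → ℂ) (i : Fin (d + 1)) :
    ∑ k : Fin (d + 1), spin d c i k * (binomWeight d k * y k) =
      binomWeight d i * ladder d c y i := by
  have hp := sum_spinPlus_mul d y i
  have hm := sum_spinMinus_mul d y i
  fin_cases c
  · simp only [spin, ladder, spinX, Fin.zero_eta, Matrix.cons_val_zero, Matrix.smul_apply,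
      Matrix.add_apply, smul_eq_mul, add_mul, mul_assoc, ← Finset.mul_sum,
      Finset.sum_add_distrib, hp, hm]
    ring
  · have hI : (1 / (2 * Complex.I) : ℂ) = -Complex.I / 2 := by
      field_simp; rw [Complex.I_sq]; norm_num
    simp only [spin, ladder, spinY, Fin.mk_one, Matrix.cons_val_one, Matrix.cons_val_zero,
      Matrix.smul_apply, Matrix.sub_apply, smul_eq_mul, sub_mul, mul_assoc, ← Finset.mul_sum,
      Finset.sum_sub_distrib, hp, hm, hI]
    ring
  · simp only [spin, ladder, spinZ, Fin.reduceFinMk, Matrix.cons_val, Matrix.diagonal_apply,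
      ite_mul, zero_mul, Finset.sum_ite_eq, Finset.mem_univ, if_true, spinValue]
    push_cast
    ring

lemma exists_eq_binomWeight_mul {d : ℕ} (x : Fin (d + 1) → ℂ) :
    ∃ y : ℕ → ℂ, x = fun k : Fin (d + 1) => binomWeight d k * y k := by
  refine ⟨fun k => if h : k < d + 1 then x ⟨k, h⟩ / binomWeight d k else 0, funext fun k => ?_⟩
  have := binomWeight_ne_zero (show (k : ℕ) ≤ d by omega)
  beta_reduce
  rw [dif_pos k.isLt, mul_div_cancel₀ _ this]

/-! ### Projectors onto eigenspaces -/

lemma mem_eigenspace_toEuclideanLin {ι : Type} [Fintype ι] [DecidableEq ι] {A : Matrix ι ι ℂ}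
    {c : ℂ} {x : EuclideanSpace ℂ ι} :
    x ∈ Module.End.eigenspace (Matrix.toEuclideanLin A) c ↔ A.mulVec x.ofLp = c • x.ofLp := by
  rw [Module.End.mem_eigenspace_iff]
  constructor
  · intro h
    have := congrArg WithLp.ofLp h
    simpa using this
  · intro h
    ext i
    simpa using congrFun h i

/-- `p x` lies in the eigenspace, and `x - p x` is orthogonal to it because `p` is Hermitian and
fixes every eigenvector. -/
lemma eigenProj_eq {ι : Type} [Fintype ι] [DecidableEq ι] {A p : Matrix ι ι ℂ} {c : ℝ}
    (hp : p.IsHermitian) (hA : ∀ x, A.mulVec (p.mulVec x) = (c : ℂ) • p.mulVec x)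
    (hfix : ∀ x, A.mulVec x = (c : ℂ) • x → p.mulVec x = x) :
    eigenProj A c = Matrix.toEuclideanCLM (n := ι) (𝕜 := ℂ) p := by
  ext1 x
  refine Submodule.eq_starProjection_of_mem_orthogonal ?_ ?_
  · rw [mem_eigenspace_toEuclideanLin]
    simpa using hA x.ofLp
  · rw [Submodule.mem_orthogonal]
    intro y hy
    have h1 := hfix _ (mem_eigenspace_toEuclideanLin.1 hy)
    have hy' : Matrix.toEuclideanLin p y = y := by
      ext i; simpa using congrFun h1 i
    have hs := (Matrix.isSymmetric_toEuclideanLin_iff.2 hp) y x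
    rw [inner_sub_right, sub_eq_zero]
    conv_lhs => rw [← hy']
    rw [hs]
    rfl

/-! ### Coherent states -/

/-- The coherent state: the eigenvector of the spin operator along `r` with the maximum
eigenvalue. -/
def coherent (d : ℕ) (r : S2) (k : Fin (d + 1)) : ℂ :=
  binomWeight d k * (up r ^ (d - k) * down r ^ (k : ℕ))

/-- The rank-one projector onto the coherent state. -/
def coherentProj (d : ℕ) (r : S2) : Matrix (Fin (d + 1)) (Fin (d + 1)) ℂ :=
  Matrix.vecMulVec (coherent d r) (star (coherent d r))

lemma coherentProj_mulVec (d : ℕ) (r : S2) (x : Fin (d + 1) → ℂ) :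
    (coherentProj d r).mulVec x = (star (coherent d r) ⬝ᵥ x) • coherent d r := by
  rw [coherentProj, Matrix.vecMulVec_mulVec]; simp

lemma isHermitian_coherentProj (d : ℕ) (r : S2) : (coherentProj d r).IsHermitian := by
  ext i j
  simp [coherentProj, Matrix.vecMulVec_apply, mul_comm]

lemma spinAlong_mulVec (d : ℕ) (r : S2) (y : ℕ → ℂ) (i : Fin (d + 1)) :
    (spinAlong d r).mulVec (fun k => binomWeight d k * y k) i =
      binomWeight d i * (up r * conj (down r) * (((d : ℂ) - i) * y (i + 1)) +
        conj (up r) * down r * (i * y (i - 1)) +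
        (up r * conj (up r) - down r * conj (down r)) * (((d : ℂ) / 2 - i) * y i)) := by
  have h : (spinAlong d r).mulVec (fun k => binomWeight d k * y k) i =
      ∑ c : Fin 3, ((r.1 c : ℝ) : ℂ) * (binomWeight d i * ladder d c y i) := by
    rw [spinAlong, Matrix.sum_mulVec, Finset.sum_apply]
    refine Finset.sum_congr rfl fun c _ => ?_
    rw [Matrix.smul_mulVec, Pi.smul_apply, smul_eq_mul, ← sum_spin_mul]
    rfl
  rw [h, Fin.sum_univ_three, up_mul_conj_down, conj_up_mul_down, up_mul_conj, down_mul_conj]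
  simp only [ladder, Matrix.cons_val_zero, Matrix.cons_val_one, Matrix.cons_val]
  ring

lemma spinAlong_mulVec_coherent (d : ℕ) (r : S2) :
    (spinAlong d r).mulVec (coherent d r) = ((spinValue d : ℝ) : ℂ) • coherent d r := by
  funext i
  have h := spinAlong_mulVec d r (fun k => up r ^ (d - k) * down r ^ k) i
  have hn := spinor_norm r
  change (spinAlong d r).mulVec (coherent d r) i = _ at h
  rw [h]
  simp only [Pi.smul_apply, coherent, smul_eq_mul, spinValue]
  obtain ⟨i, hi⟩ := i
  obtain ⟨m, rfl⟩ : ∃ m, d = i + m := ⟨d - i, by omega⟩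
  have e1 : i + m - i = m := by omega
  rcases i with _ | i <;> rcases m with _ | m
  -- The edges `i = 0` and `i = d` are separate because the exponents `i - 1` and `d - (i + 1)`
  -- truncate there; the truncated terms have coefficient 0.
  · simp
  · have e2 : 0 + (m + 1) - (0 + 1) = m := by omega
    simp only [e1, e2]
    push_cast
    linear_combination binomWeight (0 + (m + 1)) 0 * ((m + 1) / 2 : ℂ) * up r ^ (m + 1) * hn
  · have e3 : i + 1 + 0 - (i + 1 - 1) = 1 := by omega
    rw [e3]
    simp only [e1, Nat.add_sub_cancel]
    push_cast
    linear_combination binomWeight (i + 1 + 0) (i + 1) * ((i + 1) / 2 : ℂ) * down r ^ (i + 1) * hn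
  · have e2 : i + 1 + (m + 1) - (i + 1 + 1) = m := by omega
    have e3 : i + 1 + (m + 1) - (i + 1 - 1) = m + 2 := by omega
    rw [e3]
    simp only [e1, e2, Nat.add_sub_cancel]
    push_cast
    linear_combination binomWeight (i + 1 + (m + 1)) (i + 1) * ((i + 1 + (m + 1)) / 2 : ℂ) *
      up r ^ (m + 1) * down r ^ (i + 1) * hn

/-- With `D k = u y (k+1) - v y k`, the eigenvalue equation reads `(d - k) conj v D k = k conj u D
(k-1)`. If `v ≠ 0`, induction from `k = 0` gives `D k = 0`; if `v = 0`, the equation at `k + 1`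
gives `y (k + 1) = 0` at once. -/
lemma step_of_eigenvector {d : ℕ} {r : S2} {y : ℕ → ℂ}
    (h : (spinAlong d r).mulVec (fun k => binomWeight d k * y k) =
      ((spinValue d : ℝ) : ℂ) • fun k : Fin (d + 1) => binomWeight d k * y k) :
    ∀ k < d, up r * y (k + 1) = down r * y k := by
  have hn := spinor_norm r
  have rec0 : ∀ k ≤ d, ((d : ℂ) - k) * conj (down r) * (up r * y (k + 1) - down r * y k) =
      k * conj (up r) * (up r * y k - down r * y (k - 1)) := by
    intro k hk
    have h1 := congrFun h ⟨k, by omega⟩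
    rw [spinAlong_mulVec] at h1
    simp only [Pi.smul_apply, smul_eq_mul, spinValue] at h1
    apply mul_left_cancel₀ (binomWeight_ne_zero hk)
    push_cast at h1
    linear_combination h1 - binomWeight d k * y k * (d : ℂ) / 2 * hn
  by_cases hv : down r = 0
  · have hu : up r ≠ 0 := by
      rintro hu; simp [hu, hv] at hn
    intro k hk
    have h1 := rec0 (k + 1) hk
    simp only [hv, map_zero, mul_zero, zero_mul, Nat.add_sub_cancel, sub_zero] at h1 ⊢
    have hk1 : ((k + 1 : ℕ) : ℂ) ≠ 0 := by exact_mod_cast k.succ_ne_zero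
    have hu' : conj (up r) ≠ 0 := by simpa using hu
    have := h1.symm
    simpa [hk1, hu', hu, -Nat.cast_add] using this
  · have hv' : conj (down r) ≠ 0 := by simpa using hv
    intro k
    induction k with
    | zero =>
      intro hk
      have h1 := rec0 0 (by omega)
      have hd : (d : ℂ) ≠ 0 := by exact_mod_cast hk.ne'
      simpa [hd, hv', sub_eq_zero] using h1
    | succ k ih =>
      intro hk
      have h1 := rec0 (k + 1) (by omega)
      rw [Nat.add_sub_cancel, ih (by omega), sub_self, mul_zero] at h1
      have hd : (d : ℂ) - (k + 1 : ℕ) ≠ 0 := by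
        rw [sub_ne_zero]; exact_mod_cast hk.ne'
      exact sub_eq_zero.1 ((mul_eq_zero.1 h1).resolve_left (mul_ne_zero hd hv'))

/-- Proportionality of `y` to `u^(d-k) v^k`, cross-multiplied so that it also covers `u = 0` and `v
= 0`. -/
lemma pow_mul_of_step {d : ℕ} {u v : ℂ} {y : ℕ → ℂ} (h : ∀ k < d, u * y (k + 1) = v * y k)
    {k l : ℕ} (hk : k ≤ d) (hl : l ≤ d) :
    u ^ (d - k) * v ^ k * y l = u ^ (d - l) * v ^ l * y k := by
  have aux : ∀ m k, k + m ≤ d → u ^ m * y (k + m) = v ^ m * y k := by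
    intro m
    induction m with
    | zero => simp
    | succ m ih =>
      intro k hm
      have h1 := ih (k + 1) (by omega)
      have h2 := h k (by omega)
      rw [show k + 1 + m = k + (m + 1) by ring] at h1
      linear_combination u * h1 + v ^ m * h2
  have main : ∀ k l, k ≤ l → l ≤ d →
      u ^ (d - k) * v ^ k * y l = u ^ (d - l) * v ^ l * y k := by
    intro k l hkl hl
    obtain ⟨m, rfl⟩ := Nat.exists_eq_add_of_le hkl
    have h1 := aux m k hl
    rw [show d - k = (d - (k + m)) + m by omega, pow_add, pow_add]
    linear_combination u ^ (d - (k + m)) * v ^ k * h1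
  rcases le_total k l with hkl | hkl
  · exact main k l hkl hl
  · exact (main l k hkl hk).symm

lemma sum_choose_mul_spinor (d : ℕ) (r : S2) :
    ∑ k : Fin (d + 1), (d.choose k : ℂ) * spinorKernel d k k r = 1 := by
  have h := add_pow (down r * conj (down r)) (up r * conj (up r)) d
  rw [add_comm, spinor_norm, one_pow, ← Fin.sum_univ_eq_sum_range
    (fun k => (down r * conj (down r)) ^ k * (up r * conj (up r)) ^ (d - k) * (d.choose k : ℂ))] at h
  rw [h]
  refine Finset.sum_congr rfl fun k _ => ?_
  simp only [spinorKernel, map_mul, map_pow, mul_pow]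
  ring

lemma coherentProj_apply (d : ℕ) (r : S2) (i j : Fin (d + 1)) :
    coherentProj d r i j = binomWeight d i * binomWeight d j * spinorKernel d i j r := by
  simp only [coherentProj, Matrix.vecMulVec_apply, Pi.star_apply, coherent, spinorKernel,
    RCLike.star_def, map_mul, conj_binomWeight]
  ring

/-- By `pow_mul_of_step` the maximal eigenspace is the line of the coherent state, which has norm 1
by the binomial theorem. -/
lemma coherentProj_mulVec_eigenvector {d : ℕ} {r : S2} {x : Fin (d + 1) → ℂ}
    (h : (spinAlong d r).mulVec x = ((spinValue d : ℝ) : ℂ) • x) :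
    (coherentProj d r).mulVec x = x := by
  obtain ⟨y, rfl⟩ := exists_eq_binomWeight_mul x
  have hs := step_of_eigenvector h
  funext l
  simp only [Matrix.mulVec, dotProduct, coherentProj_apply]
  have h1 : ∀ k : Fin (d + 1), binomWeight d l * binomWeight d k * spinorKernel d l k r *
      (binomWeight d k * y k) =
        binomWeight d l * y l * ((d.choose k : ℂ) * spinorKernel d k k r) := by
    intro k
    have h2 := pow_mul_of_step hs (show (k : ℕ) ≤ d by omega) (show (l : ℕ) ≤ d by omega)
    rw [← binomWeight_mul_self]
    simp only [spinorKernel]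
    linear_combination -binomWeight d l * binomWeight d k ^ 2 *
      conj (up r ^ (d - k) * down r ^ (k : ℕ)) * h2
  simp_rw [h1]
  rw [← Finset.mul_sum, sum_choose_mul_spinor, mul_one]

lemma plusProj_eq (d : ℕ) (r : S2) :
    plusProj d r = Matrix.toEuclideanCLM (n := Fin (d + 1)) (𝕜 := ℂ) (coherentProj d r) := by
  refine eigenProj_eq (isHermitian_coherentProj d r) (fun x => ?_)
    fun x hx => coherentProj_mulVec_eigenvector hx
  rw [coherentProj_mulVec, Matrix.mulVec_smul, spinAlong_mulVec_coherent, smul_comm]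

lemma minusProj_eq_plusProj_neg (d : ℕ) (r : S2) : minusProj d r = plusProj d (-r) := by
  have hA : spinAlong d (-r) = -spinAlong d r := by
    simp [spinAlong, Fin.sum_univ_three]
  have hE : Module.End.eigenspace (Matrix.toEuclideanLin (spinAlong d r)) ((-spinValue d : ℝ) : ℂ) =
      Module.End.eigenspace (Matrix.toEuclideanLin (spinAlong d (-r))) ((spinValue d : ℝ) : ℂ) := by
    ext x
    rw [mem_eigenspace_toEuclideanLin, mem_eigenspace_toEuclideanLin, hA, Matrix.neg_mulVec,
      neg_eq_iff_eq_neg, Complex.ofReal_neg, neg_smul]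
  simp only [minusProj, plusProj, eigenProj, hE]

/-! ### The subspace of maximum total spin -/

/-- The action of the total spin components on coefficients rescaled by binomial weights. -/
def totalLadder (a b : ℕ) (c : Fin 3) (y : ℕ → ℕ → ℂ) (i j : ℕ) : ℂ :=
  ladder a c (fun k => y k j) i + ladder b c (y i) j

/-- The vector of two spins with the given coefficients rescaled by binomial weights. -/
def weighted (a b : ℕ) (y : ℕ → ℕ → ℂ) (p : Fin (a + 1) × Fin (b + 1)) : ℂ :=
  binomWeight a p.1 * binomWeight b p.2 * y p.1 p.2

lemma exists_eq_weighted {a b : ℕ} (x : Fin (a + 1) × Fin (b + 1) → ℂ) :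
    ∃ y : ℕ → ℕ → ℂ, x = weighted a b y := by
  refine ⟨fun i j => if h : i < a + 1 ∧ j < b + 1 then
    x (⟨i, h.1⟩, ⟨j, h.2⟩) / (binomWeight a i * binomWeight b j) else 0, funext fun p => ?_⟩
  have h1 := binomWeight_ne_zero (show (p.1 : ℕ) ≤ a by omega)
  have h2 := binomWeight_ne_zero (show (p.2 : ℕ) ≤ b by omega)
  rw [weighted, dif_pos ⟨p.1.isLt, p.2.isLt⟩, mul_div_cancel₀ _ (mul_ne_zero h1 h2)]

lemma totalSpin_mulVec_weighted (a b : ℕ) (c : Fin 3) (y : ℕ → ℕ → ℂ) :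
    (totalSpin a b c).mulVec (weighted a b y) = weighted a b (totalLadder a b c y) := by
  funext ⟨i, j⟩
  rw [totalSpin, Matrix.add_mulVec, Pi.add_apply]
  have h1 : ((spin a c ⊗ₖ (1 : Matrix (Fin (b + 1)) (Fin (b + 1)) ℂ)).mulVec (weighted a b y)) (i, j)
      = binomWeight b j * ∑ k : Fin (a + 1), spin a c i k * (binomWeight a k * y k j) := by
    simp only [Matrix.mulVec, dotProduct, Fintype.sum_prod_type, Matrix.kroneckerMap_apply,
      Matrix.one_apply, mul_ite, mul_one, mul_zero, ite_mul, zero_mul, Finset.sum_ite_eq,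
      Finset.mem_univ, if_true, weighted, Finset.mul_sum]
    exact Finset.sum_congr rfl fun k _ => by ring
  have h2 : (((1 : Matrix (Fin (a + 1)) (Fin (a + 1)) ℂ) ⊗ₖ spin b c).mulVec (weighted a b y)) (i, j)
      = binomWeight a i * ∑ l : Fin (b + 1), spin b c j l * (binomWeight b l * y i l) := by
    simp only [Matrix.mulVec, dotProduct, Fintype.sum_prod_type_right, Matrix.kroneckerMap_apply,
      Matrix.one_apply, ite_mul, one_mul, zero_mul, Finset.sum_ite_eq,
      Finset.mem_univ, if_true, weighted, Finset.mul_sum]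
    exact Finset.sum_congr rfl fun k _ => by ring
  rw [h1, h2, sum_spin_mul a c (fun k => y k j), sum_spin_mul]
  simp only [weighted, totalLadder]
  ring

/-- The squared total spin, up to its maximum value, is a discrete Laplacian along the
antidiagonals. -/
lemma sum_totalLadder_sq (a b : ℕ) (y : ℕ → ℕ → ℂ) (i j : ℕ) :
    ∑ c : Fin 3, totalLadder a b c (totalLadder a b c y) i j =
      ((a + b) / 2 * ((a + b) / 2 + 1) : ℂ) * y i j +
        ((a : ℂ) - i) * j * (y (i + 1) (j - 1) - y i j) +
        i * ((b : ℂ) - j) * (y (i - 1) (j + 1) - y i j) := by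
  rw [Fin.sum_univ_three]
  rcases i with _ | i <;> rcases j with _ | j <;>
  · simp only [totalLadder, ladder, Matrix.cons_val_zero, Matrix.cons_val_one, Matrix.cons_val,
      Nat.add_sub_cancel, Nat.cast_zero, Nat.cast_add, Nat.cast_one, zero_add, zero_mul]
    ring_nf
    simp only [Complex.I_sq]
    ring

lemma totalSpin_sq_mulVec_weighted (a b : ℕ) (y : ℕ → ℕ → ℂ) :
    (∑ i : Fin 3, totalSpin a b i * totalSpin a b i).mulVec (weighted a b y) =
      weighted a b fun i j => ((a + b) / 2 * ((a + b) / 2 + 1) : ℂ) * y i j +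
        ((a : ℂ) - i) * j * (y (i + 1) (j - 1) - y i j) +
        i * ((b : ℂ) - j) * (y (i - 1) (j + 1) - y i j) := by
  funext p
  simp only [Matrix.sum_mulVec, ← Matrix.mulVec_mulVec, totalSpin_mulVec_weighted,
    Finset.sum_apply, weighted, ← Finset.mul_sum, sum_totalLadder_sq]

lemma maxSpin_mul_eq (a b : ℕ) : ((maxSpin a b * (maxSpin a b + 1) : ℝ) : ℂ) =
    (a + b) / 2 * ((a + b) / 2 + 1) := by
  simp only [maxSpin, spinValue]; push_cast; ring

/-- Maximum total spin means that the rescaled coefficients depend only on `i + j`. Forward, by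
induction on `i`: in the Laplacian equation at `(i, j + 1)` the difference towards `i - 1` vanishes,
by the induction hypothesis or because its coefficient is 0, which leaves the difference towards `i
+ 1`. -/
lemma eigenvector_iff_antidiagonal {a b : ℕ} {y : ℕ → ℕ → ℂ} :
    (∑ i : Fin 3, totalSpin a b i * totalSpin a b i).mulVec (weighted a b y) =
        ((maxSpin a b * (maxSpin a b + 1) : ℝ) : ℂ) • weighted a b y ↔
      ∀ i < a, ∀ j < b, y (i + 1) j = y i (j + 1) := by
  rw [totalSpin_sq_mulVec_weighted, maxSpin_mul_eq]
  constructor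
  · intro h
    have key : ∀ i ≤ a, ∀ j ≤ b, ((a : ℂ) - i) * j * (y (i + 1) (j - 1) - y i j) +
        i * ((b : ℂ) - j) * (y (i - 1) (j + 1) - y i j) = 0 := by
      intro i hi j hj
      have h1 := congrFun h (⟨i, by omega⟩, ⟨j, by omega⟩)
      simp only [weighted, Pi.smul_apply, smul_eq_mul] at h1
      have h2 := mul_ne_zero (binomWeight_ne_zero hi) (binomWeight_ne_zero hj)
      apply mul_left_cancel₀ h2
      linear_combination h1
    intro i
    induction i with
    | zero =>
      intro hi j hj
      have h1 := key 0 (by omega) (j + 1) (by omega)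
      have ha : (a : ℂ) ≠ 0 := by exact_mod_cast hi.ne'
      have hj' : (j : ℂ) + 1 ≠ 0 := by exact_mod_cast j.succ_ne_zero
      simpa [ha, hj', sub_eq_zero] using h1
    | succ i ih =>
      intro hi j hj
      have h1 := key (i + 1) (by omega) (j + 1) (by omega)
      have ha : (a : ℂ) - (i + 1 : ℕ) ≠ 0 := by rw [sub_ne_zero]; exact_mod_cast hi.ne'
      have hj' : ((j + 1 : ℕ) : ℂ) ≠ 0 := by exact_mod_cast j.succ_ne_zero
      have h2 : ((i + 1 : ℕ) : ℂ) * ((b : ℂ) - (j + 1 : ℕ)) *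
          (y (i + 1 - 1) (j + 1 + 1) - y (i + 1) (j + 1)) = 0 := by
        rcases (show j + 1 ≤ b from hj).eq_or_lt with hb | hb
        · simp [hb]
        · rw [Nat.add_sub_cancel, ih (by omega) (j + 1) hb, sub_self, mul_zero]
      rw [h2, add_zero, Nat.add_sub_cancel] at h1
      exact sub_eq_zero.1 ((mul_eq_zero.1 h1).resolve_left (mul_ne_zero ha hj'))
  · intro h
    funext ⟨i, j⟩
    simp only [weighted, Pi.smul_apply, smul_eq_mul]
    have h1 : ((a : ℂ) - (i : ℕ)) * (j : ℕ) * (y (i + 1) (j - 1) - y i j) = 0 := by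
      rcases (show (i : ℕ) ≤ a by omega).eq_or_lt with hi | hi
      · simp [hi]
      · rcases Nat.eq_zero_or_pos (j : ℕ) with hj | hj
        · simp [hj]
        · have := h i hi (j - 1) (by omega)
          rw [this, Nat.sub_add_cancel hj, sub_self, mul_zero]
    have h2 : ((i : ℕ) : ℂ) * ((b : ℂ) - (j : ℕ)) * (y (i - 1) (j + 1) - y i j) = 0 := by
      rcases (show (j : ℕ) ≤ b by omega).eq_or_lt with hj | hj
      · simp [hj]
      · rcases Nat.eq_zero_or_pos (i : ℕ) with hi | hi
        · simp [hi]
        · have := h (i - 1) (by omega) j hj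
          rw [← this, Nat.sub_add_cancel hi, sub_self, mul_zero]
    linear_combination binomWeight a i * binomWeight b j * (h1 + h2)

lemma eq_of_antidiagonal {a b : ℕ} {y : ℕ → ℕ → ℂ}
    (h : ∀ i < a, ∀ j < b, y (i + 1) j = y i (j + 1)) {i j k l : ℕ} (hi : i ≤ a) (hj : j ≤ b)
    (hk : k ≤ a) (hl : l ≤ b) (hs : i + j = k + l) : y i j = y k l := by
  have aux : ∀ m i j, i + m ≤ a → j + m ≤ b → y (i + m) j = y i (j + m) := by
    intro m
    induction m with
    | zero => simp
    | succ m ih =>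
      intro i j h1 h2
      have h3 := h (i + m) (by omega) j (by omega)
      have h4 := ih i (j + 1) (by omega) (by omega)
      rw [← add_assoc, h3, h4]
      congr 1; ring
  rcases le_total i k with hik | hik
  · obtain ⟨m, rfl⟩ := Nat.exists_eq_add_of_le hik
    obtain rfl : j = l + m := by omega
    exact (aux m i l hk hj).symm
  · obtain ⟨m, rfl⟩ := Nat.exists_eq_add_of_le hik
    obtain rfl : l = j + m := by omega
    exact aux m k j hi hl

/-- Vandermonde's identity: the squared norm of the weighted indicator of the antidiagonal `i + j =
m` is `(a + b).choose m`. This is the normalization in `maxSpinProj`. -/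
lemma sum_choose_mul_choose (a b m : ℕ) :
    ∑ q : Fin (a + 1) × Fin (b + 1),
      (if m = (q.1 : ℕ) + q.2 then (a.choose q.1 : ℂ) * (b.choose q.2 : ℂ) else 0) =
        ((a + b).choose m : ℂ) := by
  rw [Nat.add_choose_eq, Fintype.sum_prod_type]
  rw [Fin.sum_univ_eq_sum_range (fun i => ∑ j : Fin (b + 1),
    (if m = i + (j : ℕ) then (a.choose i : ℂ) * (b.choose j : ℂ) else 0)) (a + 1)]
  simp_rw [fun i => Fin.sum_univ_eq_sum_range (fun j =>
    (if m = i + j then (a.choose i : ℂ) * (b.choose j : ℂ) else 0)) (b + 1)]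
  rw [← Finset.sum_product', ← Finset.sum_filter]
  push_cast
  refine Finset.sum_subset ?_ ?_
  · intro q hq
    have hq := (Finset.mem_filter.1 hq).2
    exact Finset.HasAntidiagonal.mem_antidiagonal.2 hq.symm
  · rintro ⟨i, j⟩ hq hq'
    have hq := Finset.HasAntidiagonal.mem_antidiagonal.1 hq
    simp only [Finset.mem_filter, Finset.mem_product, Finset.mem_range, not_and] at hq'
    by_cases hi : i < a + 1
    · have hj : ¬ j < b + 1 := fun hj => hq' ⟨hi, hj⟩ hq.symm
      simp [Nat.choose_eq_zero_of_lt (show b < j by omega)]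
    · simp [Nat.choose_eq_zero_of_lt (show a < i by omega)]

/-- The matrix of the projector onto the subspace of maximum total spin. -/
def maxSpinProj (a b : ℕ) :
    Matrix (Fin (a + 1) × Fin (b + 1)) (Fin (a + 1) × Fin (b + 1)) ℂ :=
  Matrix.of fun p q => binomWeight a p.1 * binomWeight b p.2 *
    (if (p.1 : ℕ) + p.2 = q.1 + q.2 then
      binomWeight a q.1 * binomWeight b q.2 / ((a + b).choose (p.1 + p.2) : ℂ) else 0)

lemma isHermitian_maxSpinProj (a b : ℕ) : (maxSpinProj a b).IsHermitian := by
  ext p q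
  simp only [maxSpinProj, Matrix.conjTranspose_apply, Matrix.of_apply, RCLike.star_def, map_mul,
    conj_binomWeight]
  by_cases h : (p.1 : ℕ) + p.2 = q.1 + q.2
  · simp only [h, if_true, map_div₀, map_mul, conj_binomWeight, map_natCast]
    ring
  · simp [h, Ne.symm h]

lemma maxSpinProj_mulVec_of_antidiagonal {a b : ℕ} {y : ℕ → ℕ → ℂ}
    (h : ∀ i < a, ∀ j < b, y (i + 1) j = y i (j + 1)) :
    (maxSpinProj a b).mulVec (weighted a b y) = weighted a b y := by
  funext p
  have hc : ((a + b).choose (p.1 + p.2) : ℂ) ≠ 0 := by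
    exact_mod_cast (Nat.choose_pos (by omega)).ne'
  have h1 : ∀ q : Fin (a + 1) × Fin (b + 1), maxSpinProj a b p q * weighted a b y q =
      weighted a b y p / ((a + b).choose (p.1 + p.2) : ℂ) *
        (if (p.1 : ℕ) + p.2 = q.1 + q.2 then (a.choose q.1 : ℂ) * (b.choose q.2 : ℂ) else 0) := by
    intro q
    simp only [maxSpinProj, Matrix.of_apply, weighted]
    split_ifs with hpq
    · rw [eq_of_antidiagonal h (by omega) (by omega) (by omega) (by omega) hpq,
        ← binomWeight_mul_self a q.1, ← binomWeight_mul_self b q.2]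
      ring
    · simp
  simp only [Matrix.mulVec, dotProduct]
  simp_rw [h1]
  rw [← Finset.mul_sum, sum_choose_mul_choose, div_mul_cancel₀ _ hc]

lemma exists_maxSpinProj_mulVec (a b : ℕ) (x : Fin (a + 1) × Fin (b + 1) → ℂ) :
    ∃ g : ℕ → ℂ, (maxSpinProj a b).mulVec x = weighted a b fun i j => g (i + j) := by
  refine ⟨fun m => ∑ q : Fin (a + 1) × Fin (b + 1), (if m = (q.1 : ℕ) + q.2 then
      binomWeight a q.1 * binomWeight b q.2 / ((a + b).choose m : ℂ) else 0) * x q,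
    funext fun p => ?_⟩
  simp only [Matrix.mulVec, dotProduct, weighted, maxSpinProj, Matrix.of_apply, Finset.mul_sum,
    mul_assoc]

lemma P_eq (a b : ℕ) : P a b =
    Matrix.toEuclideanCLM (n := Fin (a + 1) × Fin (b + 1)) (𝕜 := ℂ) (maxSpinProj a b) := by
  refine eigenProj_eq (isHermitian_maxSpinProj a b) (fun x => ?_) fun x hx => ?_
  · obtain ⟨g, hg⟩ := exists_maxSpinProj_mulVec a b x
    rw [hg, eigenvector_iff_antidiagonal]
    intro i _ j _
    congr 1; ring
  · obtain ⟨y, rfl⟩ := exists_eq_weighted x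
    exact maxSpinProj_mulVec_of_antidiagonal (eigenvector_iff_antidiagonal.1 hx)

lemma maxSpinProj_mul_self (a b : ℕ) : maxSpinProj a b * maxSpinProj a b = maxSpinProj a b := by
  refine Matrix.mulVec_injective (funext fun x => ?_)
  obtain ⟨g, hg⟩ := exists_maxSpinProj_mulVec a b x
  rw [← Matrix.mulVec_mulVec, hg, maxSpinProj_mulVec_of_antidiagonal]
  intro i _ j _
  congr 1; ring

lemma trace_maxSpinProj (a b : ℕ) : (maxSpinProj a b).trace = (a + b + 1 : ℂ) := by
  -- Grouping by antidiagonals, each `m ≤ a + b` contributes exactly 1 to the trace.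
  have h1 : ∀ p : Fin (a + 1) × Fin (b + 1), maxSpinProj a b p p =
      ∑ m ∈ Finset.range (a + b + 1), ((a + b).choose m : ℂ)⁻¹ *
        (if m = (p.1 : ℕ) + p.2 then (a.choose p.1 : ℂ) * (b.choose p.2 : ℂ) else 0) := by
    intro p
    rw [Finset.sum_eq_single ((p.1 : ℕ) + p.2)]
    · simp only [maxSpinProj, Matrix.of_apply, if_true]
      rw [← binomWeight_mul_self a p.1, ← binomWeight_mul_self b p.2]
      ring
    · intro m _ hm
      simp [hm]
    · intro hm
      exact absurd (Finset.mem_range.2 (by omega)) hm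
  simp only [Matrix.trace, Matrix.diag_apply]
  simp_rw [h1]
  rw [Finset.sum_comm]
  simp_rw [← Finset.mul_sum, sum_choose_mul_choose]
  rw [Finset.sum_congr rfl (g := fun _ => (1 : ℂ))]
  · simp
  · intro m hm
    have : ((a + b).choose m : ℂ) ≠ 0 := by
      exact_mod_cast (Nat.choose_pos (by have := Finset.mem_range.1 hm; omega)).ne'
    exact inv_mul_cancel₀ this

/-! ### The isotropic distribution -/

/-- The action of a linear isometry on the unit sphere. -/
def sphereMap (g : E3 ≃ₗᵢ[ℝ] E3) (r : S2) : S2 := ⟨g r.1, by simp⟩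

lemma continuous_sphereMap (g : E3 ≃ₗᵢ[ℝ] E3) : Continuous (sphereMap g) :=
  (g.continuous.comp continuous_subtype_val).subtype_mk _

/-- The surface measure of a set is a multiple of the volume of the cone over it, and a linear
isometry carries cones to cones and preserves volume. -/
lemma map_toSphere_sphereMap (g : E3 ≃ₗᵢ[ℝ] E3) :
    (volume : Measure E3).toSphere.map (sphereMap g) = (volume : Measure E3).toSphere := by
  ext s hs
  have hm := (continuous_sphereMap g).measurable
  rw [Measure.map_apply hm hs, Measure.toSphere_apply' _ (hm hs), Measure.toSphere_apply' _ hs]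
  congr 1
  have himg : Set.Ioo (0 : ℝ) 1 • (Subtype.val '' (sphereMap g ⁻¹' s)) =
      g ⁻¹' (Set.Ioo (0 : ℝ) 1 • (Subtype.val '' s)) := by
    ext x
    simp only [Set.mem_smul, Set.mem_image, Set.mem_preimage]
    constructor
    · rintro ⟨t, ht, _, ⟨r, hr, rfl⟩, rfl⟩
      exact ⟨t, ht, _, ⟨_, hr, rfl⟩, by simp [sphereMap]⟩
    · rintro ⟨t, ht, _, ⟨r, hr, rfl⟩, h⟩
      refine ⟨t, ht, _, ⟨sphereMap g.symm r, ?_, rfl⟩, ?_⟩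
      · have : sphereMap g (sphereMap g.symm r) = r := by ext; simp [sphereMap]
        rwa [this]
      · apply g.injective
        simp [sphereMap, h]
  rw [himg]
  exact g.measurePreserving.measure_preimage_emb g.toHomeomorph.measurableEmbedding _

lemma map_isotropic_sphereMap (g : E3 ≃ₗᵢ[ℝ] E3) : isotropic.map (sphereMap g) = isotropic := by
  rw [isotropic, Measure.map_smul, map_toSphere_sphereMap]

instance : IsProbabilityMeasure isotropic where
  measure_univ := by
    rw [isotropic, Measure.smul_apply, smul_eq_mul]
    refine ENNReal.inv_mul_cancel ?_ (measure_ne_top _ _)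
    rw [Measure.measure_univ_ne_zero]
    exact Measure.toSphere_ne_zero _

lemma integral_isotropic_sphereMap {E : Type*} [NormedAddCommGroup E] [NormedSpace ℝ E]
    (g : E3 ≃ₗᵢ[ℝ] E3) (f : S2 → E) :
    ∫ r, f (sphereMap g r) ∂isotropic = ∫ r, f r ∂isotropic := by
  have hemb : MeasurableEmbedding (sphereMap g) := by
    refine (Homeomorph.mk (Equiv.mk (sphereMap g) (sphereMap g.symm) ?_ ?_)
      (continuous_sphereMap g) (continuous_sphereMap g.symm)).measurableEmbedding
    · intro r; ext; simp [sphereMap]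
    · intro r; ext; simp [sphereMap]
  conv_rhs => rw [← map_isotropic_sphereMap g]
  rw [hemb.integral_map]

/-- The rotation about the third axis by the angle `θ`. -/
def rotZ (θ : ℝ) : E3 ≃ₗᵢ[ℝ] E3 :=
  LinearIsometry.toLinearIsometryEquiv
    { toFun := fun r => !₂[Real.cos θ * r 0 - Real.sin θ * r 1,
        Real.sin θ * r 0 + Real.cos θ * r 1, r 2]
      map_add' := fun r s => by ext i; fin_cases i <;> simp <;> ring
      map_smul' := fun c r => by ext i; fin_cases i <;> simp <;> ring
      norm_map' := fun r => by
        rw [EuclideanSpace.norm_eq, EuclideanSpace.norm_eq]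
        congr 1
        simp only [Fin.sum_univ_three, Real.norm_eq_abs, sq_abs]
        simp
        linear_combination (r 0 ^ 2 + r 1 ^ 2) * Real.sin_sq_add_cos_sq θ } rfl

lemma rotZ_apply (θ : ℝ) (r : E3) : rotZ θ r = !₂[Real.cos θ * r 0 - Real.sin θ * r 1,
    Real.sin θ * r 0 + Real.cos θ * r 1, r 2] := rfl

lemma up_mul_conj_rotZ (θ : ℝ) (r : S2) :
    up (sphereMap (rotZ θ) r) * conj (up (sphereMap (rotZ θ) r)) = up r * conj (up r) := by
  rw [up_mul_conj, up_mul_conj]; simp [sphereMap, rotZ_apply]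

lemma down_mul_conj_rotZ (θ : ℝ) (r : S2) :
    down (sphereMap (rotZ θ) r) * conj (down (sphereMap (rotZ θ) r)) = down r * conj (down r) := by
  rw [down_mul_conj, down_mul_conj]; simp [sphereMap, rotZ_apply]

lemma conj_up_mul_down_rotZ (θ : ℝ) (r : S2) :
    conj (up (sphereMap (rotZ θ) r)) * down (sphereMap (rotZ θ) r) =
      Complex.exp (θ * Complex.I) * (conj (up r) * down r) := by
  rw [conj_up_mul_down, conj_up_mul_down, Complex.exp_mul_I]
  simp [sphereMap, rotZ_apply]
  linear_combination (-Complex.sin θ * (r.1 1 : ℂ) / 2) * Complex.I_sq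

/-- Written through phase-independent products, whose behaviour under rotation is known; the chosen
spinor of a rotated point need not be the rotated spinor. -/
lemma spinorKernel_eq_of_le {n K L : ℕ} (hL : L ≤ K) (hK : K ≤ n) (r : S2) :
    spinorKernel n K L r = (up r * conj (up r)) ^ (n - K) * (conj (up r) * down r) ^ (K - L) *
      (down r * conj (down r)) ^ L := by
  obtain ⟨m, rfl⟩ := Nat.exists_eq_add_of_le hL
  obtain ⟨l, rfl⟩ := Nat.exists_eq_add_of_le hK
  have e1 : L + m + l - (L + m) = l := by omega
  have e2 : L + m + l - L = m + l := by omega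
  simp only [spinorKernel, e1, e2, Nat.add_sub_cancel_left, map_mul, map_pow, mul_pow, pow_add]
  ring

lemma conj_spinorKernel (n K L : ℕ) (r : S2) :
    conj (spinorKernel n K L r) = spinorKernel n L K r := by
  simp only [spinorKernel, map_mul, Complex.conj_conj]; ring

/-- A rotation by `θ` about the third axis multiplies the kernel by `exp (i θ (K - L))`, and `θ = π
/ (K - L)` reverses its sign. -/
lemma integral_spinorKernel_of_lt {n K L : ℕ} (hL : L < K) (hK : K ≤ n) :
    ∫ r, spinorKernel n K L r ∂isotropic = 0 := by
  set θ : ℝ := Real.pi / (K - L : ℕ)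
  have hexp : Complex.exp (θ * Complex.I) ^ (K - L) = -1 := by
    have h0 : ((K - L : ℕ) : ℂ) ≠ 0 := by exact_mod_cast (Nat.sub_pos_of_lt hL).ne'
    rw [← Complex.exp_nat_mul, ← Complex.exp_pi_mul_I]
    congr 1
    simp only [θ]
    push_cast [-Nat.cast_sub]
    field_simp
  have h := integral_isotropic_sphereMap (rotZ θ) (spinorKernel n K L)
  have h2 : ∀ r, spinorKernel n K L (sphereMap (rotZ θ) r) = -spinorKernel n K L r := by
    intro r
    rw [spinorKernel_eq_of_le hL.le hK, spinorKernel_eq_of_le hL.le hK, up_mul_conj_rotZ,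
      down_mul_conj_rotZ, conj_up_mul_down_rotZ,
      mul_pow (Complex.exp _), hexp]
    ring
  simp_rw [h2] at h
  rw [integral_neg] at h
  exact self_eq_neg.1 h.symm

lemma integral_spinorKernel_of_ne {n K L : ℕ} (h : K ≠ L) (hK : K ≤ n) (hL : L ≤ n) :
    ∫ r, spinorKernel n K L r ∂isotropic = 0 := by
  rcases h.lt_or_gt with h | h
  · simp_rw [← conj_spinorKernel n L K]
    rw [integral_conj, integral_spinorKernel_of_lt h hL, map_zero]
  · exact integral_spinorKernel_of_lt h hK

/-- The reflection exchanging `w` with the third basis vector. -/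
lemma exists_sphereMap_two {w : E3} (hw : ‖w‖ = 1) :
    ∃ g : E3 ≃ₗᵢ[ℝ] E3, ∀ r : S2, inner ℝ w (sphereMap g r).1 = r.1 2 := by
  set e : E3 := EuclideanSpace.single 2 1
  have hg : (ℝ ∙ (w - e))ᗮ.reflection w = e := Submodule.reflection_sub (by simp [hw, e])
  refine ⟨(ℝ ∙ (w - e))ᗮ.reflection, fun r => ?_⟩
  have h : inner ℝ w ((ℝ ∙ (w - e))ᗮ.reflection r.1) = inner ℝ e r.1 := by
    have h1 := LinearIsometryEquiv.inner_map_map (ℝ ∙ (w - e))ᗮ.reflection w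
      ((ℝ ∙ (w - e))ᗮ.reflection r.1)
    rw [Submodule.reflection_reflection, hg] at h1
    exact h1.symm
  rw [sphereMap, h]
  simp [e, EuclideanSpace.inner_single_left]

lemma integral_isotropic_affine_pow (n : ℕ) {w : E3} (hw : ‖w‖ = 1) :
    ∫ r : S2, ((1 + (inner ℝ w r.1 : ℝ)) / 2 : ℂ) ^ n ∂isotropic =
      ∫ r : S2, ((1 + (r.1 2 : ℝ)) / 2 : ℂ) ^ n ∂isotropic := by
  obtain ⟨g, hg⟩ := exists_sphereMap_two hw
  rw [← integral_isotropic_sphereMap g]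
  simp_rw [hg]

/-- Both sides are `|u + t v|^(2n)`; the vector on the right is the Bloch vector of the spinor `(1,
t)` after normalization. -/
lemma sum_sum_spinorKernel (n : ℕ) (t : ℝ) (r : S2) :
    ∑ K ∈ Finset.range (n + 1), ∑ L ∈ Finset.range (n + 1),
      (n.choose K * n.choose L * (t : ℂ) ^ (K + L)) * spinorKernel n K L r =
    (1 + (t : ℂ) ^ 2) ^ n * ((1 + (inner ℝ (!₂[2 * t / (1 + t ^ 2), 0, (1 - t ^ 2) / (1 + t ^ 2)] : E3)
      r.1 : ℝ)) / 2 : ℂ) ^ n := by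
  have ht : (1 + (t : ℂ) ^ 2) ≠ 0 := by
    have : (1 + t ^ 2 : ℝ) ≠ 0 := by positivity
    exact_mod_cast this
  have h1 : ((1 + (t : ℂ) ^ 2) * ((1 + (inner ℝ (!₂[2 * t / (1 + t ^ 2), 0,
      (1 - t ^ 2) / (1 + t ^ 2)] : E3) r.1 : ℝ)) / 2 : ℂ)) =
      (t * down r + up r) * (t * conj (down r) + conj (up r)) := by
    have e1 := up_mul_conj r
    have e2 := down_mul_conj r
    have e3 := up_mul_conj_down r
    have e4 := conj_up_mul_down r
    simp only [PiLp.inner_apply, Fin.sum_univ_three, RCLike.inner_apply, conj_trivial]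
    simp
    field_simp
    linear_combination -2 * e1 - 2 * (t : ℂ) ^ 2 * e2 - 2 * (t : ℂ) * e3 - 2 * (t : ℂ) * e4
  rw [← mul_pow, h1, mul_pow, add_pow, add_pow, Finset.sum_mul_sum]
  refine Finset.sum_congr rfl fun K _ => Finset.sum_congr rfl fun L _ => ?_
  simp only [spinorKernel, mul_pow, map_mul, map_pow, pow_add]
  ring

lemma sum_choose_sq_mul_integral (n : ℕ) (t : ℝ) :
    ∑ K ∈ Finset.range (n + 1), (n.choose K : ℂ) ^ 2 * (∫ r, spinorKernel n K K r ∂isotropic) *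
        ((t : ℂ) ^ 2) ^ K =
      (1 + (t : ℂ) ^ 2) ^ n * ∫ r : S2, ((1 + (r.1 2 : ℝ)) / 2 : ℂ) ^ n ∂isotropic := by
  have hw : ‖(!₂[2 * t / (1 + t ^ 2), 0, (1 - t ^ 2) / (1 + t ^ 2)] : E3)‖ = 1 := by
    have ht : 1 + t ^ 2 ≠ 0 := by positivity
    rw [EuclideanSpace.norm_eq, Real.sqrt_eq_one, Fin.sum_univ_three]
    simp only [Real.norm_eq_abs, sq_abs]
    simp
    field_simp
    ring
  rw [← integral_isotropic_affine_pow n hw, ← integral_const_mul]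
  simp_rw [← sum_sum_spinorKernel]
  have hint : ∀ K ∈ Finset.range (n + 1), ∀ L ∈ Finset.range (n + 1), Integrable (fun r =>
      (n.choose K * n.choose L * (t : ℂ) ^ (K + L)) * spinorKernel n K L r) isotropic :=
    fun K hK L hL => (integrable_spinorKernel _ (by have := Finset.mem_range.1 hK; omega)
      (by have := Finset.mem_range.1 hL; omega)).const_mul _
  rw [integral_finsetSum _ fun K hK => integrable_finsetSum _ (hint K hK)]
  refine Finset.sum_congr rfl fun K hK => ?_
  rw [integral_finsetSum _ (hint K hK), Finset.sum_eq_single K]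
  · rw [integral_const_mul, pow_add]; ring
  · intro L hL hne
    rw [integral_const_mul, integral_spinorKernel_of_ne hne.symm
      (by have := Finset.mem_range.1 hK; omega) (by have := Finset.mem_range.1 hL; omega), mul_zero]
  · exact fun h => absurd hK h

/-- In `sum_choose_sq_mul_integral` the isotropic integral on the right does not depend on `t`. The
identity is thus one of polynomials in `t²`, and the coefficients of degree `K` are compared. -/
lemma choose_mul_integral_spinorKernel {n K : ℕ} (hK : K ≤ n) :
    (n.choose K : ℂ) * ∫ r, spinorKernel n K K r ∂isotropic =
      ∫ r : S2, ((1 + (r.1 2 : ℝ)) / 2 : ℂ) ^ n ∂isotropic := by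
  set c : ℂ := ∫ r : S2, ((1 + (r.1 2 : ℝ)) / 2 : ℂ) ^ n ∂isotropic with hc
  set p : Polynomial ℂ := ∑ K ∈ Finset.range (n + 1), Polynomial.C ((n.choose K : ℂ) ^ 2 *
    ∫ r, spinorKernel n K K r ∂isotropic) * Polynomial.X ^ K with hp
  have hpq : p = Polynomial.C c * (1 + Polynomial.X) ^ n := by
    refine Polynomial.eq_of_infinite_eval_eq _ _
      (Set.infinite_of_injective_forall_mem (f := fun k : ℕ => (k : ℂ) ^ 2) ?_ ?_)
    · intro k l hkl
      beta_reduce at hkl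
      have : k ^ 2 = l ^ 2 := by exact_mod_cast hkl
      exact Nat.pow_left_injective two_ne_zero this
    · intro k
      have h := sum_choose_sq_mul_integral n k
      rw [← hc] at h
      simp only [Complex.ofReal_natCast] at h
      simp only [Set.mem_ofPred_eq, hp, Polynomial.eval_finsetSum, Polynomial.eval_mul,
        Polynomial.eval_C, Polynomial.eval_pow, Polynomial.eval_X, Polynomial.eval_add,
        Polynomial.eval_one]
      rw [h, mul_comm]
  have h := congrArg (fun q => Polynomial.coeff q K) hpq
  simp only [hp, Polynomial.finsetSum_coeff, Polynomial.coeff_C_mul, Polynomial.coeff_X_pow,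
    Polynomial.coeff_one_add_X_pow, mul_ite, mul_one, mul_zero, Finset.sum_ite_eq,
    Finset.mem_range, show K < n + 1 by omega, if_true] at h
  have h0 : (n.choose K : ℂ) ≠ 0 := by exact_mod_cast (Nat.choose_pos hK).ne'
  apply mul_left_cancel₀ h0
  linear_combination h

/-- The `n + 1` weighted diagonal kernels sum to 1 and have equal averages. -/
lemma integral_isotropic_pow (n : ℕ) :
    ∫ r : S2, ((1 + (r.1 2 : ℝ)) / 2 : ℂ) ^ n ∂isotropic = 1 / (n + 1) := by
  have h : ∫ r, ∑ k : Fin (n + 1), (n.choose k : ℂ) * spinorKernel n k k r ∂isotropic = 1 := by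
    simp_rw [sum_choose_mul_spinor]
    simp
  rw [integral_finsetSum _ fun k _ => (integrable_spinorKernel _ (by omega) (by omega)).const_mul _]
    at h
  simp_rw [integral_const_mul] at h
  rw [Finset.sum_congr rfl fun k _ => choose_mul_integral_spinorKernel (by omega)] at h
  have hn : (n + 1 : ℂ) ≠ 0 := by exact_mod_cast n.succ_ne_zero
  rw [eq_div_iff hn, mul_comm]
  simpa using h

lemma integral_spinorKernel_isotropic {n K L : ℕ} (hK : K ≤ n) (hL : L ≤ n) :
    ∫ r, spinorKernel n K L r ∂isotropic =
      if K = L then 1 / ((n + 1) * (n.choose K : ℂ)) else 0 := by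
  split_ifs with h
  · subst h
    have h0 : (n.choose K : ℂ) ≠ 0 := by exact_mod_cast (Nat.choose_pos hK).ne'
    have hn : (n + 1 : ℂ) ≠ 0 := by exact_mod_cast n.succ_ne_zero
    have h1 := choose_mul_integral_spinorKernel hK
    rw [integral_isotropic_pow] at h1
    apply mul_left_cancel₀ h0
    rw [h1]
    field_simp
  · exact integral_spinorKernel_of_ne h hK hL

/-! ### The bond verification operator -/

lemma toEuclideanCLM_injective {ι : Type} [Fintype ι] [DecidableEq ι] :
    Function.Injective (Matrix.toEuclideanCLM (n := ι) (𝕜 := ℂ)) :=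
  EquivLike.injective _

/-- `Matrix.toEuclideanCLM` as a linear equivalence. -/
def matrixOpEquiv (ι : Type) [Fintype ι] [DecidableEq ι] : Matrix ι ι ℂ ≃ₗ[ℂ] Op ι where
  toFun := Matrix.toEuclideanCLM (n := ι) (𝕜 := ℂ)
  invFun := (Matrix.toEuclideanCLM (n := ι) (𝕜 := ℂ)).symm
  map_add' := map_add _
  map_smul' := map_smul _
  left_inv := StarAlgEquiv.symm_apply_apply _
  right_inv := StarAlgEquiv.apply_symm_apply _

lemma continuous_toEuclideanCLM {ι : Type} [Fintype ι] [DecidableEq ι] :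
    Continuous (Matrix.toEuclideanCLM (n := ι) (𝕜 := ℂ)) :=
  LinearMap.continuous_of_finiteDimensional (matrixOpEquiv ι).toLinearMap

/-- Each matrix entry is a continuous linear functional of the operator, so it commutes with the
integral. -/
lemma integral_toEuclideanCLM {ι : Type} [Fintype ι] [DecidableEq ι] {f : S2 → Matrix ι ι ℂ}
    (hf : Continuous f) (κ : Measure S2) [IsFiniteMeasure κ] :
    Integrable (fun r => Matrix.toEuclideanCLM (n := ι) (𝕜 := ℂ) (f r)) κ ∧
    ∫ r, Matrix.toEuclideanCLM (n := ι) (𝕜 := ℂ) (f r) ∂κ =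
      Matrix.toEuclideanCLM (n := ι) (𝕜 := ℂ) (Matrix.of fun i j => ∫ r, f r i j ∂κ) := by
  have hint : Integrable (fun r => Matrix.toEuclideanCLM (n := ι) (𝕜 := ℂ) (f r)) κ :=
    integrable_of_continuous κ (continuous_toEuclideanCLM.comp hf)
  refine ⟨hint, ?_⟩
  apply (matrixOpEquiv ι).symm.injective
  ext i j
  let ℓ : Op ι →ₗ[ℂ] ℂ := (Matrix.entryLinearMap ℂ ℂ i j).comp (matrixOpEquiv ι).symm.toLinearMap
  have hℓ (A : Matrix ι ι ℂ) : LinearMap.toContinuousLinearMap ℓ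
      (Matrix.toEuclideanCLM (n := ι) (𝕜 := ℂ) A) = A i j :=
    congrFun (congrFun ((matrixOpEquiv ι).symm_apply_apply A) i) j
  have h := (LinearMap.toContinuousLinearMap ℓ).integral_comp_comm hint
  simp_rw [hℓ] at h
  exact h.symm.trans (hℓ (Matrix.of fun i j => ∫ r, f r i j ∂κ)).symm

/-- The matrix of the projector onto the product of two coherent states. -/
def bondMatrix (a b : ℕ) (r : S2) :
    Matrix (Fin (a + 1) × Fin (b + 1)) (Fin (a + 1) × Fin (b + 1)) ℂ :=
  coherentProj a r ⊗ₖ coherentProj b r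

lemma bondMatrix_apply (a b : ℕ) (r : S2) (p q : Fin (a + 1) × Fin (b + 1)) :
    bondMatrix a b r p q = (binomWeight a p.1 * binomWeight b p.2) *
      (binomWeight a q.1 * binomWeight b q.2) *
        spinorKernel (a + b) (p.1 + p.2) (q.1 + q.2) r := by
  rw [bondMatrix, Matrix.kroneckerMap_apply, coherentProj_apply, coherentProj_apply,
    ← spinorKernel_mul (by omega) (by omega) (by omega) (by omega)]
  ring

lemma continuous_bondMatrix (a b : ℕ) : Continuous (bondMatrix a b) := by
  refine continuous_matrix fun p q => ?_
  simp_rw [bondMatrix_apply]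
  exact continuous_const.mul (continuous_spinorKernel (by omega) (by omega))

lemma bondTest_eq (a b : ℕ) (r : S2) : bondTest a b r =
    1 - Matrix.toEuclideanCLM (n := Fin (a + 1) × Fin (b + 1)) (𝕜 := ℂ) (bondMatrix a b r) -
      Matrix.toEuclideanCLM (n := Fin (a + 1) × Fin (b + 1)) (𝕜 := ℂ) (bondMatrix a b (-r)) := by
  simp only [bondTest, tensorOp, minusProj_eq_plusProj_neg, plusProj_eq,
    StarAlgEquiv.symm_apply_apply, bondMatrix]

instance (μ : Measure S2) [IsProbabilityMeasure μ] : IsProbabilityMeasure (symmetrization μ) where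
  measure_univ := by
    have hneg : Measurable fun r : S2 => -r := continuous_neg.measurable
    rw [symmetrization, Measure.smul_apply, Measure.add_apply, Measure.map_apply hneg .univ]
    simp [one_add_one_eq_two, ENNReal.inv_mul_cancel]

lemma integral_symmetrization {E : Type*} [NormedAddCommGroup E] [NormedSpace ℝ E]
    (μ : Measure S2) [IsProbabilityMeasure μ] {f : S2 → E} (hf : Continuous f) :
    ∫ r, f r ∂(symmetrization μ) = (2 : ℝ)⁻¹ • (∫ r, f r ∂μ + ∫ r, f (-r) ∂μ) := by
  have hneg : Measurable fun r : S2 => -r := continuous_neg.measurable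
  have : IsProbabilityMeasure (μ.map fun r => -r) := Measure.isProbabilityMeasure_map hneg.aemeasurable
  rw [symmetrization, integral_smul_measure, integral_add_measure (integrable_of_continuous _ hf)
    (integrable_of_continuous _ hf),
    integral_map hneg.aemeasurable hf.aestronglyMeasurable]
  simp

/-- The matrix of the average of the coherent product projectors over the symmetrization. -/
def averagedBondMatrix (a b : ℕ) (μ : Measure S2) :
    Matrix (Fin (a + 1) × Fin (b + 1)) (Fin (a + 1) × Fin (b + 1)) ℂ :=
  Matrix.of fun p q => ∫ r, bondMatrix a b r p q ∂(symmetrization μ)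

lemma averagedBondMatrix_apply (a b : ℕ) (μ : Measure S2) (p q : Fin (a + 1) × Fin (b + 1)) :
    averagedBondMatrix a b μ p q = (binomWeight a p.1 * binomWeight b p.2) *
      (binomWeight a q.1 * binomWeight b q.2) *
        ∫ r, spinorKernel (a + b) (p.1 + p.2) (q.1 + q.2) r ∂(symmetrization μ) := by
  rw [averagedBondMatrix, Matrix.of_apply, ← integral_const_mul]
  simp_rw [bondMatrix_apply]

lemma bondVerification_eq (a b : ℕ) (μ : Measure S2) [IsProbabilityMeasure μ] :
    bondVerification a b μ = Matrix.toEuclideanCLM (n := Fin (a + 1) × Fin (b + 1)) (𝕜 := ℂ)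
      (1 - (2 : ℂ) • averagedBondMatrix a b μ) := by
  have hc := continuous_bondMatrix a b
  have h1 := (integral_toEuclideanCLM hc μ).1
  have h2 : Integrable (fun r => Matrix.toEuclideanCLM (n := Fin (a + 1) × Fin (b + 1)) (𝕜 := ℂ)
      (bondMatrix a b (-r))) μ := (integral_toEuclideanCLM (hc.comp continuous_neg) μ).1
  have h0 : Integrable (fun _ : S2 => (1 : BondOp a b)) μ := integrable_const _
  have hT : Continuous fun r =>
      Matrix.toEuclideanCLM (n := Fin (a + 1) × Fin (b + 1)) (𝕜 := ℂ) (bondMatrix a b r) :=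
    continuous_toEuclideanCLM.comp hc
  have h3 := integral_symmetrization μ hT
  rw [(integral_toEuclideanCLM hc (symmetrization μ)).2] at h3
  rw [bondVerification]
  simp_rw [bondTest_eq]
  have h01 : Integrable (fun r => (1 : BondOp a b) -
      Matrix.toEuclideanCLM (n := Fin (a + 1) × Fin (b + 1)) (𝕜 := ℂ) (bondMatrix a b r)) μ :=
    h0.sub h1
  rw [integral_sub h01 h2, integral_sub h0 h1,
    map_sub, map_one, map_smul, averagedBondMatrix, h3, integral_const, probReal_univ, one_smul,
    ← Complex.coe_smul, smul_smul, sub_sub]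
  norm_num

lemma isHermitian_averagedBondMatrix (a b : ℕ) (μ : Measure S2) :
    (averagedBondMatrix a b μ).IsHermitian := by
  ext p q
  rw [Matrix.conjTranspose_apply, averagedBondMatrix_apply, averagedBondMatrix_apply,
    RCLike.star_def, map_mul, ← integral_conj]
  simp_rw [conj_spinorKernel]
  simp only [map_mul, conj_binomWeight]
  ring

/-- Each column, rescaled, depends on `i + j` only, so it is a vector of maximum total spin. -/
lemma maxSpinProj_mul_averagedBondMatrix (a b : ℕ) (μ : Measure S2) :
    maxSpinProj a b * averagedBondMatrix a b μ = averagedBondMatrix a b μ := by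
  ext p q
  have h : (fun p => averagedBondMatrix a b μ p q) = weighted a b fun i j =>
      (binomWeight a q.1 * binomWeight b q.2) *
        ∫ r, spinorKernel (a + b) (i + j) (q.1 + q.2) r ∂(symmetrization μ) := by
    funext p
    rw [averagedBondMatrix_apply, weighted, mul_assoc]
  have h2 := congrFun (maxSpinProj_mulVec_of_antidiagonal (a := a) (b := b) (y := fun i j =>
      (binomWeight a q.1 * binomWeight b q.2) *
        ∫ r, spinorKernel (a + b) (i + j) (q.1 + q.2) r ∂(symmetrization μ)) (fun i _ j _ => by
          simp only [show i + 1 + j = i + (j + 1) by ring])) p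
  rw [← h] at h2
  exact h2

lemma averagedBondMatrix_mul_maxSpinProj (a b : ℕ) (μ : Measure S2) :
    averagedBondMatrix a b μ * maxSpinProj a b = averagedBondMatrix a b μ := by
  have h := congrArg Matrix.conjTranspose (maxSpinProj_mul_averagedBondMatrix a b μ)
  rwa [Matrix.conjTranspose_mul, isHermitian_averagedBondMatrix, isHermitian_maxSpinProj] at h

lemma trace_bondMatrix (a b : ℕ) (r : S2) : (bondMatrix a b r).trace = 1 := by
  have h (d : ℕ) : (coherentProj d r).trace = 1 := by
    rw [← sum_choose_mul_spinor d r]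
    refine Finset.sum_congr rfl fun k _ => ?_
    rw [Matrix.diag_apply, coherentProj_apply, binomWeight_mul_self]
  rw [bondMatrix, Matrix.trace_kronecker, h, h, mul_one]

lemma trace_averagedBondMatrix (a b : ℕ) (μ : Measure S2) [IsProbabilityMeasure μ] :
    (averagedBondMatrix a b μ).trace = 1 := by
  have h : ∫ r, (bondMatrix a b r).trace ∂(symmetrization μ) = 1 := by
    simp_rw [trace_bondMatrix]; simp
  rw [← h]
  simp only [Matrix.trace, Matrix.diag_apply, averagedBondMatrix, Matrix.of_apply]
  rw [integral_finsetSum]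
  intro p _
  exact integrable_of_continuous _ ((continuous_bondMatrix a b).matrix_elem p p)

/-! ### The equivalences -/

lemma bondVerification_eq_iff (a b : ℕ) (μ : Measure S2) [IsProbabilityMeasure μ] (c : ℝ) :
    bondVerification a b μ = Q a b + c • P a b ↔
      (2 : ℂ) • averagedBondMatrix a b μ = (1 - c : ℂ) • maxSpinProj a b := by
  have h : Q a b + c • P a b = Matrix.toEuclideanCLM (n := Fin (a + 1) × Fin (b + 1)) (𝕜 := ℂ)
      (1 - maxSpinProj a b + (c : ℂ) • maxSpinProj a b) := by
    rw [Q, P_eq, map_add, map_sub, map_one, map_smul]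
    rfl
  rw [h, bondVerification_eq, toEuclideanCLM_injective.eq_iff, sub_smul, one_smul,
    sub_add, sub_right_inj]

lemma maxSpin_eq (a b : ℕ) : 2 * maxSpin a b = a + b := by
  simp only [maxSpin, spinValue]; ring

lemma eq_smul_maxSpinProj_iff_isSphericalDesign (a b : ℕ) (μ : Measure S2)
    [IsProbabilityMeasure μ] :
    averagedBondMatrix a b μ = (1 / (a + b + 1) : ℂ) • maxSpinProj a b ↔
      IsSphericalDesign (a + b) (symmetrization μ) := by
  rw [IsSphericalDesign, forall_integral_eval_eq_iff]
  have key (p q : Fin (a + 1) × Fin (b + 1)) :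
      ((1 / (a + b + 1) : ℂ) • maxSpinProj a b) p q =
        (binomWeight a p.1 * binomWeight b p.2) * (binomWeight a q.1 * binomWeight b q.2) *
          ∫ r, spinorKernel (a + b) (p.1 + p.2) (q.1 + q.2) r ∂isotropic := by
    rw [integral_spinorKernel_isotropic (by omega) (by omega), Matrix.smul_apply, maxSpinProj,
      Matrix.of_apply, smul_eq_mul]
    split_ifs
    · push_cast
      field_simp
    · simp
  constructor
  · intro h K L hK hL
    -- Every `K ≤ a + b` occurs as `i + j` with `i = min K a ≤ a` and `j ≤ b`, so the matrix entries
    -- reach all the kernels.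
    have h1 := congrFun (congrFun h
      (⟨min K a, by omega⟩, ⟨K - min K a, by omega⟩)) (⟨min L a, by omega⟩, ⟨L - min L a, by omega⟩)
    rw [key, averagedBondMatrix_apply] at h1
    have hw (M : ℕ) (hM : M ≤ a + b) :
        binomWeight a (min M a) * binomWeight b (M - min M a) ≠ 0 :=
      mul_ne_zero (binomWeight_ne_zero (by omega)) (binomWeight_ne_zero (by omega))
    have h2 := mul_left_cancel₀ (mul_ne_zero (hw K hK) (hw L hL)) h1
    simpa only [Nat.add_sub_cancel' (min_le_left _ _)] using h2
  · intro h
    ext p q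
    rw [key, averagedBondMatrix_apply, h _ _ (by omega) (by omega)]

lemma norm_P (a b : ℕ) : ‖P a b‖ = 1 := by
  have hle : ‖P a b‖ ≤ 1 := Submodule.starProjection_norm_le _
  have hmul : P a b * P a b = P a b := by
    rw [P_eq, ← map_mul, maxSpinProj_mul_self]
  have hne : P a b ≠ 0 := by
    intro h
    rw [P_eq, ← map_zero (Matrix.toEuclideanCLM (n := Fin (a + 1) × Fin (b + 1)) (𝕜 := ℂ))] at h
    replace h := toEuclideanCLM_injective h
    have h1 := trace_maxSpinProj a b
    rw [h, Matrix.trace_zero] at h1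
    have : ((a + b + 1 : ℕ) : ℂ) ≠ 0 := Nat.cast_ne_zero.2 (Nat.succ_ne_zero _)
    push_cast at this
    exact this h1.symm
  have hpos : 0 < ‖P a b‖ := norm_pos_iff.2 hne
  have h2 : ‖P a b‖ ≤ ‖P a b‖ * ‖P a b‖ := by
    conv_lhs => rw [← hmul]
    exact norm_mul_le _ _
  nlinarith

/-- A Hermitian matrix supported on a projector and bounded by `c` in norm is at most `c` times
the projector. -/
lemma posSemidef_smul_sub {ι : Type} [Fintype ι] [DecidableEq ι] {X A : Matrix ι ι ℂ} {c : ℝ}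
    (hX : X.IsHermitian) (hA : A.IsHermitian) (hXX : X * X = X) (hXAX : X * A * X = A)
    (hn : ‖Matrix.toEuclideanCLM (n := ι) (𝕜 := ℂ) A‖ ≤ c) : ((c : ℂ) • X - A).PosSemidef := by
  have hH : ((c : ℂ) • X - A).IsHermitian := by
    refine Matrix.IsHermitian.sub ?_ hA
    rw [Matrix.IsHermitian, Matrix.conjTranspose_smul, hX]
    simp
  rw [← Matrix.isPositive_toEuclideanLin_iff]
  refine ⟨Matrix.isSymmetric_toEuclideanLin_iff.2 hH, fun x => ?_⟩
  set X' := Matrix.toEuclideanCLM (n := ι) (𝕜 := ℂ) X with hX'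
  set A' := Matrix.toEuclideanCLM (n := ι) (𝕜 := ℂ) A with hA'
  have hsymm (u v) : inner ℂ (X' u) v = inner ℂ u (X' v) :=
    (Matrix.isSymmetric_toEuclideanLin_iff.2 hX) u v
  have hXX' (u) : X' (X' u) = X' u := by
    rw [← mul_apply_eq_comp, hX', ← map_mul, hXX]
  have hXAX' : A' x = X' (A' (X' x)) := by
    rw [← mul_apply_eq_comp, ← mul_apply_eq_comp, hX', hA', ← map_mul,
      ← map_mul, hXAX]
  have h1 : inner ℂ (A' x) x = inner ℂ (A' (X' x)) (X' x) := by
    rw [hXAX', hsymm]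
  have h2 : inner ℂ (X' x) x = inner ℂ (X' x) (X' x) := by
    rw [hsymm, hsymm, hXX']
  have h3 : Matrix.toEuclideanLin ((c : ℂ) • X - A) x = (c : ℂ) • X' x - A' x := by
    rw [map_sub, map_smul]; rfl
  rw [h3, inner_sub_left, inner_smul_left, h1, h2, inner_self_eq_norm_sq_to_K, map_sub, sub_nonneg]
  have h4 : RCLike.re (inner ℂ (A' (X' x)) (X' x)) ≤ c * ‖X' x‖ ^ 2 := by
    calc RCLike.re (inner ℂ (A' (X' x)) (X' x)) ≤ ‖A' (X' x)‖ * ‖X' x‖ := re_inner_le_norm _ _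
      _ ≤ (c * ‖X' x‖) * ‖X' x‖ := by
        gcongr
        exact (A'.le_opNorm _).trans (by gcongr)
      _ = c * ‖X' x‖ ^ 2 := by ring
  refine h4.trans (le_of_eq ?_)
  rw [Complex.conj_ofReal]
  rw [← RCLike.ofReal_pow]
  exact (Complex.re_ofReal_mul c ((‖X' x‖ ^ 2 : ℝ) : ℂ)).symm

lemma eq_smul_of_norm_eq {a b : ℕ} {μ : Measure S2} [IsProbabilityMeasure μ]
    (h : ‖bondVerification a b μ - Q a b‖ = 1 - 2 / (a + b + 1)) :
    averagedBondMatrix a b μ = (1 / (a + b + 1) : ℂ) • maxSpinProj a b := by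
  set X := maxSpinProj a b
  set N := averagedBondMatrix a b μ
  have hn : (a + b + 1 : ℂ) ≠ 0 := by exact_mod_cast (a + b).succ_ne_zero
  have hO : bondVerification a b μ - Q a b =
      Matrix.toEuclideanCLM (n := Fin (a + 1) × Fin (b + 1)) (𝕜 := ℂ) (X - (2 : ℂ) • N) := by
    rw [bondVerification_eq, Q, P_eq, map_sub, map_sub, map_one]
    abel
  rw [hO] at h
  have hX : X.IsHermitian := isHermitian_maxSpinProj a b
  have hN : N.IsHermitian := isHermitian_averagedBondMatrix a b μ
  have hXN : X * N = N := maxSpinProj_mul_averagedBondMatrix a b μ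
  have hNX : N * X = N := averagedBondMatrix_mul_maxSpinProj a b μ
  have hXX : X * X = X := maxSpinProj_mul_self a b
  have hps := posSemidef_smul_sub hX (A := X - (2 : ℂ) • N)
    (hX.sub (by rw [Matrix.IsHermitian, Matrix.conjTranspose_smul, hN]; simp)) hXX
    (by rw [mul_sub, sub_mul, hXX, hXX, mul_smul_comm, hXN, smul_mul_assoc, hNX]) h.le
  -- The trace is `(1 - 2 / (n + 1)) (n + 1) - (n + 1) + 2 = 0`, and a positive semidefinite matrix
  -- of trace 0 vanishes.
  have htr : (((1 - 2 / (a + b + 1) : ℝ) : ℂ) • X - (X - (2 : ℂ) • N)).trace = 0 := by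
    rw [Matrix.trace_sub, Matrix.trace_sub, Matrix.trace_smul, Matrix.trace_smul,
      trace_maxSpinProj, trace_averagedBondMatrix]
    push_cast
    simp only [smul_eq_mul]
    field_simp
    ring
  have h0 := hps.trace_eq_zero_iff.1 htr
  have h1 : (2 : ℂ) • N = (2 / (a + b + 1) : ℂ) • X := by
    rw [← sub_eq_zero, ← h0]
    push_cast
    module
  apply smul_right_injective _ (two_ne_zero : (2 : ℂ) ≠ 0)
  simp only [h1, smul_smul]
  congr 1
  ring

end

end AKLT

theorem theorem3 (a b : ℕ) (ha : 1 ≤ a) (hb : 1 ≤ b)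
    (μ : MeasureTheory.Measure AKLT.S2) [MeasureTheory.IsProbabilityMeasure μ] :
    List.TFAE [
      AKLT.spectralGap (AKLT.Q a b) (AKLT.bondVerification a b μ)
        = 2 / (2 * AKLT.maxSpin a b + 1),
      AKLT.bondVerification a b μ
        = AKLT.Q a b +
          ((2 * AKLT.maxSpin a b - 1) / (2 * AKLT.maxSpin a b + 1)) • AKLT.P a b,
      AKLT.IsHomogeneous (AKLT.Q a b) (AKLT.bondVerification a b μ),
      AKLT.IsSphericalDesign (a + b) (AKLT.symmetrization μ)] := by
  have hnR : (0 : ℝ) < a + b + 1 := by positivity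
  have hnC : (a + b + 1 : ℂ) ≠ 0 := by exact_mod_cast (a + b).succ_ne_zero
  have ha' : (1 : ℝ) ≤ a := by exact_mod_cast ha
  have hb' : (1 : ℝ) ≤ b := by exact_mod_cast hb
  have hPQ : 1 - AKLT.Q a b = AKLT.P a b := by rw [AKLT.Q, sub_sub_cancel]
  rw [AKLT.maxSpin_eq]
  have h2 : AKLT.bondVerification a b μ =
        AKLT.Q a b + (((a : ℝ) + b - 1) / (a + b + 1)) • AKLT.P a b ↔
      AKLT.averagedBondMatrix a b μ = (1 / (a + b + 1) : ℂ) • AKLT.maxSpinProj a b := by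
    have e : (1 - ((((a : ℝ) + b - 1) / (a + b + 1) : ℝ) : ℂ)) = 2 * (1 / (a + b + 1) : ℂ) := by
      push_cast
      field_simp
      ring
    rw [AKLT.bondVerification_eq_iff, e, mul_smul,
      (smul_right_injective _ (two_ne_zero : (2 : ℂ) ≠ 0)).eq_iff]
  tfae_have 1 → 2 := by
    intro h
    rw [h2]
    apply AKLT.eq_smul_of_norm_eq
    rw [AKLT.spectralGap] at h
    linarith
  tfae_have 2 → 1 := by
    intro h
    rw [AKLT.spectralGap, h, add_sub_cancel_left, norm_smul, AKLT.norm_P, mul_one,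
      Real.norm_of_nonneg (div_nonneg (by linarith) hnR.le)]
    field_simp
    ring
  tfae_have 2 → 3 := by
    intro h
    refine ⟨((a : ℝ) + b - 1) / (a + b + 1), div_nonneg (by linarith) hnR.le, ?_, by rw [hPQ]; exact h⟩
    rw [div_lt_one hnR]
    linarith
  tfae_have 3 → 2 := by
    rintro ⟨c, -, -, h⟩
    rw [hPQ] at h
    -- Traces give `2 = (1 - c) (a + b + 1)`, which determines `c`.
    have h1 := congrArg Matrix.trace ((AKLT.bondVerification_eq_iff a b μ c).1 h)
    rw [Matrix.trace_smul, Matrix.trace_smul, AKLT.trace_averagedBondMatrix,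
      AKLT.trace_maxSpinProj, smul_eq_mul, smul_eq_mul] at h1
    have h3 : (2 : ℝ) * 1 = (1 - c) * (a + b + 1) := by exact_mod_cast h1
    have hc : c = ((a : ℝ) + b - 1) / (a + b + 1) := by
      rw [eq_div_iff hnR.ne']
      linarith
    rw [h, hc]
  tfae_have 2 ↔ 4 := h2.trans (AKLT.eq_smul_maxSpinProj_iff_isSphericalDesign a b μ)
  tfae_finish
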